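/- Let $\mathbb D$ be the open unit disk, $b_w(x)=\frac{x-w}{1-\overline w x}$ for $w\in\mathbb D$, $U(a)=\frac1{\sqrt{1-|a|^2}}\begin{bmatrix}1&a\\ \overline a&1\end{bmatrix}$ for $a\in\mathbb D$, and $D_k(x)=\begin{bmatrix}b_{z_k}(x)&0\\0&1\end{bmatrix}$. Let $p\ge1$ and let $\{z_k\}_{k\ge0}\subset\mathbb D$ satisfy $z_0=0$ and $z_{k+p}=z_k$ for all $k$; put $B_k=\prod_{j=1}^k b_{z_j}$ and $\eta_k=\sqrt{1-|z_k|^2}$. For $\varphi$ in $\mathcal L_k=\mathrm{span}\{B_0,\dots,B_k\}$ put $\varphi^*(x)=B_k(x)\,\overline{\varphi(1/\overline x)}$ (an identity of rational functions; functions with index $k$ are reversed with $B_k$). Given $\{a_k\}_{k\ge0}\subset\mathbb D$, let $\varphi_0\equiv1$ and let the rational functions $\varphi_k$ be generated by $$\begin{bmatrix}\varphi_{k+1}(x)\\ \varphi_{k+1}^*(x)\end{bmatrix}=\frac{1-\overline{z_k}x}{1-\overline{z_{k+1}}x}\,\frac{\eta_{k+1}}{\eta_k}\,U(-\overline{a_k})\,D_k(x)\begin{bmatrix}\varphi_k(x)\\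 \varphi_k^*(x)\end{bmatrix}.$$ Let $\nu$ be a probability measure on $\partial\mathbb D$ for which the $\varphi_k$ are orthonormal in $L^2(\nu)$ (the measure associated with $\{a_k\}$), let $F_\nu(x)=\int\frac{t+x}{t-x}\,d\nu(t)$, $x\in\mathbb D$, be its Carathéodory function, and let $\psi_0\equiv1$ and, for $k\ge1$, $\psi_k(x)=\int(\varphi_k(t)-\varphi_k(x))\frac{t+x}{t-x}\,d\nu(t)$; these $\psi_k$ are rational functions. Finally let $Y_0=\begin{bmatrix}1&1\\-1&1\end{bmatrix}$ and $$M(x)=\begin{bmatrix}M_{11}(x)&M_{12}(x)\\M_{21}(x)&M_{22}(x)\end{bmatrix}=Y_0\,D_0(x)U(a_0)\,D_1(x)U(a_1)\cdots D_{p-1}(x)U(a_{p-1})\,Y_0^{-1}.$$ (a) If $F_\nu^{(1)}$ is the Carathéodory function of a probability measure associated in the same way with the shifted coefficients $\{a_{k+p}\}_{k\ge0}$ (and the same $z_k$), then for all $x\in\mathbb D$ one has $M_{21}(x)F_\nu^{(1)}(x)+M_{22}(x)\neq0$ and $$F_\nu(x)=\frac{M_{11}(x)F_\nu^{(1)}(x)+M_{12}(x)}{M_{21}(x)F_\nu^{(1)}(x)+M_{22}(x)}.$$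 (b) For every $x\in\mathbb C$ with $\overline{z_k}x\ne1$ for all $k$, $$M(x)=\frac12\begin{bmatrix}\psi_p(x)+\psi_p^*(x)&\psi_p^*(x)-\psi_p(x)\\ \varphi_p^*(x)-\varphi_p(x)&\varphi_p(x)+\varphi_p^*(x)\end{bmatrix}.$$ (c) Suppose that $a_{k+p}=e^{-2i\vartheta}a_k$ for all $k$, with $\vartheta\in\mathbb R$. Then there is an analytic function $f:\mathbb D\to\overline{\mathbb D}$ with $F_\nu(x)=\frac{1+xf(x)}{1-xf(x)}$ on $\mathbb D$ (the Schur function of $\nu$), and every such $f$ satisfies, for each $x\in\mathbb D$, $$\begin{bmatrix}f(x)\\1\end{bmatrix}\sim T(x)\begin{bmatrix}f(x)\\1\end{bmatrix},\qquad T(x)=U(a_0)D_1(x)U(a_1)\cdots D_{p-1}(x)U(a_{p-1})D_0(x)\begin{bmatrix}e^{-i\vartheta}&0\\0&e^{i\vartheta}\end{bmatrix},$$ where $v\sim w$ means $v=\lambda w$ for some nonzero $\lambda\in\mathbb C$. -/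

import Mathlib

open scoped ComplexConjugate

namespace ORF

noncomputable section

/-- The unit circle in the complex plane. -/
abbrev UnitCircle : Type := Metric.sphere (0 : ℂ) 1

/-- The value of a rational function at a complex number that is not one of its poles. -/
def ev (f : RatFunc ℂ) (w : ℂ) : ℂ := RatFunc.eval (RingHom.id ℂ) w f

/-- The elementary Blaschke factor `(x - w) / (1 - conj w * x)` as a function of `x`. -/
def b (w x : ℂ) : ℂ := (x - w) / (1 - conj w * x)

/-- The elementary Blaschke factor with zero `w`, as a rational function. -/
def bRat (w : ℂ) : RatFunc ℂ :=
  (RatFunc.X - RatFunc.C w) / (1 - RatFunc.C (conj w) * RatFunc.X)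

/-- The finite Blaschke product `b_{z_1} ⋯ b_{z_k}`; the index starts at `1`. -/
def bProd (z : ℕ → ℂ) (k : ℕ) : RatFunc ℂ := ∏ j ∈ Finset.Icc 1 k, bRat (z j)

/-- The rational function `x ↦ conj (f (1 / conj x))`: the coefficients of `f` are conjugated and
`X⁻¹` is substituted for `X`. -/
def sharp (f : RatFunc ℂ) : RatFunc ℂ :=
  RatFunc.eval ((RatFunc.C : ℂ →+* RatFunc ℂ).comp (starRingEnd ℂ)) (RatFunc.X)⁻¹ f

/-- The reversed function of index `k`: `f^*(x) = B_k(x) * conj (f (1 / conj x))`. -/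
def rev (z : ℕ → ℂ) (k : ℕ) (f : RatFunc ℂ) : RatFunc ℂ := bProd z k * sharp f

/-- The matrix `U(a) = (1 - |a|^2)^(-1/2) [1, a; conj a, 1]`. -/
def U (a : ℂ) : Matrix (Fin 2) (Fin 2) ℂ :=
  ((1 / Real.sqrt (1 - ‖a‖ ^ 2) : ℝ) : ℂ) • !![1, a; conj a, 1]

/-- The diagonal matrix with entries `b_w(x)` and `1`. -/
def D (w x : ℂ) : Matrix (Fin 2) (Fin 2) ℂ := !![b w x, 0; 0, 1]

/-- The number `η = (1 - |w|^2)^(1/2)`. -/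
def eta (w : ℂ) : ℂ := ((Real.sqrt (1 - ‖w‖ ^ 2) : ℝ) : ℂ)

/-- The scalar prefactor of the recurrence that leads from index `k` to index `k + 1`. -/
def prefactor (z : ℕ → ℂ) (k : ℕ) : RatFunc ℂ :=
  (1 - RatFunc.C (conj (z k)) * RatFunc.X) / (1 - RatFunc.C (conj (z (k + 1))) * RatFunc.X)
    * RatFunc.C (eta (z (k + 1)) / eta (z k))

/-- The rational functions `φ_k` generated by the coefficients `a`: `φ_0 = 1` and `φ_{k+1}` is the
first row of
`[φ_{k+1}; φ_{k+1}^*] = prefactor * U(-conj a_k) * diag(b_{z_k}, 1) * [φ_k; φ_k^*]`.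
The second row is the image of the first under the reversal of index `k + 1`. -/
def phi (z a : ℕ → ℂ) : ℕ → RatFunc ℂ
  | 0 => 1
  | k + 1 =>
      prefactor z k *
        (RatFunc.C (U (-conj (a k)) 0 0) * (bRat (z k) * phi z a k)
          + RatFunc.C (U (-conj (a k)) 0 1) * rev z k (phi z a k))

/-- `ν` is a measure of orthogonality for the sequence `φ`: the `φ_k` are orthonormal in
`L²(ν)`. -/
def IsOrthogonalityMeasure (ν : MeasureTheory.Measure UnitCircle) (φ : ℕ → RatFunc ℂ) : Prop :=
  ∀ j k : ℕ, ∫ t : UnitCircle, ev (φ j) t * conj (ev (φ k) t) ∂ν = if j = k then 1 else 0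

/-- The Carathéodory function of `ν`. -/
def caratheodory (ν : MeasureTheory.Measure UnitCircle) (w : ℂ) : ℂ :=
  ∫ t : UnitCircle, ((t : ℂ) + w) / ((t : ℂ) - w) ∂ν

/-- `ψ` is the sequence of rational functions of the second kind of the sequence `φ` with respect
to `ν`: `ψ_0 = 1`, and for `k ≥ 1` the value of `ψ_k` at `w` is
`∫ (φ_k(t) - φ_k(w)) (t + w) / (t - w) dν(t)`
at every point `w` off the unit circle that is not a pole of `φ_k`. -/
def IsSecondKind (ν : MeasureTheory.Measure UnitCircle) (φ ψ : ℕ → RatFunc ℂ) : Prop :=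
  ψ 0 = 1 ∧
    ∀ k : ℕ, 1 ≤ k → ∀ w : ℂ, ‖w‖ ≠ 1 → (φ k).denom.eval w ≠ 0 →
      (ψ k).denom.eval w ≠ 0 ∧
      ev (ψ k) w
        = ∫ t : UnitCircle, (ev (φ k) t - ev (φ k) w) * (((t : ℂ) + w) / ((t : ℂ) - w)) ∂ν

/-- The matrix `Y_0 = [ψ_0, φ_0; -ψ_0^*, φ_0^*]`. -/
def Y0 : Matrix (Fin 2) (Fin 2) ℂ := !![1, 1; -1, 1]

/-- The transfer matrix
`M(w) = Y_0 * D_0(w) * U(a_0) * D_1(w) * U(a_1) * ⋯ * D_{p-1}(w) * U(a_{p-1}) * Y_0⁻¹`,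
where `D_k(w)` is the diagonal matrix with entries `b_{z_k}(w)` and `1`. -/
def M (z a : ℕ → ℂ) (p : ℕ) (w : ℂ) : Matrix (Fin 2) (Fin 2) ℂ :=
  Y0 * ((List.range p).map fun k => D (z k) w * U (a k)).prod * Y0⁻¹

/-- The matrix
`T(w) = U(a_0) * D_1(w) * U(a_1) * ⋯ * D_{p-1}(w) * U(a_{p-1}) * D_p(w) * diag(e^{-iϑ}, e^{iϑ})`;
for a `p`-periodic sequence `z` the factor `D_p` is `D_0`. -/
def T (z a : ℕ → ℂ) (p : ℕ) (ϑ : ℝ) (w : ℂ) : Matrix (Fin 2) (Fin 2) ℂ :=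
  ((List.range p).map fun k => U (a k) * D (z (k + 1)) w).prod
    * !![Complex.exp (-(Complex.I * ϑ)), 0; 0, Complex.exp (Complex.I * ϑ)]

/-- `f` is the Schur function associated with the Carathéodory function `F`: it is analytic on the
open unit disk with values in the closed unit disk, and `F(w) = (1 + w f(w)) / (1 - w f(w))`. -/
def IsSchurFunctionOf (f F : ℂ → ℂ) : Prop :=
  DifferentiableOn ℂ f (Metric.ball 0 1) ∧
    (∀ w : ℂ, ‖w‖ < 1 → ‖f w‖ ≤ 1) ∧
    ∀ w : ℂ, ‖w‖ < 1 → F w = (1 + w * f w) / (1 - w * f w)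

/-- Two vectors represent the same point of the projective line. -/
def ProjEq (v₁ v₂ : Fin 2 → ℂ) : Prop := ∃ c : ℂ, c ≠ 0 ∧ v₁ = c • v₂

end

end ORF

/-!
The functions `φ_k` enter only through one consequence of orthonormality, `∫ φ_k dν = 0` for
`k ≥ 1`. Together with `z 0 = 0` it makes the error terms vanish when the recurrence for
`(φ_k, φ_k^*)` is integrated against a Cauchy kernel `1 / (t - w)`, so that Cauchy integrals of
`φ_k`, `φ_k^*` and of their conjugates satisfy recurrences of the same shape.

For the transfer matrix, write `φ_k = P_k / π_k` and `φ_k^* = Q_k / π_k` with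
`π_k = ∏_{j=1}^k (1 - conj (z_j) X)`, and let `S_k, R_k` solve the recurrence of `P_k, Q_k` with the
initial values `1, -1` instead of `1, 1`. Both sides of
`S_k + F P_k = 2 π_k ∫ t φ_k(t) / (t - w) dν` satisfy the same recurrence
(`numPair_add_caratheodory_mul`), which identifies `S_k / π_k` with the function of the second kind
`ψ_k`; reversal sends it to `-R_k / π_k`. One step of the recurrence is multiplication of the row
`(P_k, -Q_k)` by `D_k U(a_k)` from the right, and over a period the scalar factors multiply to `π_p`
(`numPair_vecMul_period`). This gives the formula for `M`.

For the remaining parts, the conjugated recurrence on the circle shows that the quotients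
`(1 - conj (z_k) w) ∫ conj φ_k / (t - w) dν / ∫ (t - z_k) conj φ_k^* / (t - w) dν`
are the iterates of the multipoint Schur algorithm of the Schur function of `ν`, with nodes
`z_{k+1}` and parameters `a_k` (`isSchurIterates_schurIter`); their bound by one comes from a Schwarz lemma,
`norm_le_of_norm_b_mul_le`. A Schur function is determined by its parameters
(`IsSchurIterates.unique`), since two functions with the same first `n` parameters differ by at most
twice the modulus of the Blaschke product of `n` nodes, which tends to zero for periodic nodes.
Hence the `p`-th iterate for `ν` is the Schur function of `ν₁`, and it is the rotation of the Schur
function of `ν` by `e^{-2iϑ}` if the parameters are periodic up to that phase. Writing the first `p`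
steps of the algorithm projectively (`IsSchurIterates.exists_smul`) turns these two facts into
coefficient stripping and into the fixed-point relation for `T`.
-/

namespace ORF

open Filter Topology MeasureTheory

/-! ### Blaschke factors and a Schwarz lemma -/

lemma one_sub_conj_mul_ne_zero {z w : ℂ} (hz : ‖z‖ < 1) (hw : ‖w‖ ≤ 1) : 1 - conj z * w ≠ 0 := by
  intro h
  have h1 : ‖conj z * w‖ < 1 := by
    rw [norm_mul, RCLike.norm_conj]
    calc ‖z‖ * ‖w‖ ≤ ‖z‖ * 1 := by gcongr
      _ < 1 := by linarith
  rw [← sub_eq_zero.mp h, norm_one] at h1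
  exact lt_irrefl _ h1

lemma normSq_sub_conj_mul (a x y : ℂ) :
    Complex.normSq (x - conj a * y) - Complex.normSq (y - a * x)
      = (1 - Complex.normSq a) * (Complex.normSq x - Complex.normSq y) := by
  simp only [Complex.normSq_apply, Complex.sub_re, Complex.sub_im, Complex.mul_re, Complex.mul_im,
    Complex.conj_re, Complex.conj_im]
  ring

/-- The matrix `U (-conj a)` preserves the cone `‖y‖ ≤ ‖x‖`. -/
lemma norm_sub_mul_le {a x y : ℂ} (ha : ‖a‖ < 1) (h : ‖y‖ ≤ ‖x‖) :
    ‖y - a * x‖ ≤ ‖x - conj a * y‖ := by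
  have e := normSq_sub_conj_mul a x y
  simp only [Complex.normSq_eq_norm_sq] at e
  have h1 : 0 ≤ (1 - ‖a‖ ^ 2) * (‖x‖ ^ 2 - ‖y‖ ^ 2) := by
    apply mul_nonneg
    · nlinarith [norm_nonneg a]
    · nlinarith [norm_nonneg y]
  exact (sq_le_sq₀ (norm_nonneg _) (norm_nonneg _)).mp (by linarith)

lemma norm_b_lt_one {z w : ℂ} (hz : ‖z‖ < 1) (hw : ‖w‖ < 1) : ‖b z w‖ < 1 := by
  have h0 := one_sub_conj_mul_ne_zero hz hw.le
  rw [b, norm_div, div_lt_one (norm_pos_iff.mpr h0)]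
  have e := normSq_sub_conj_mul z 1 w
  simp only [Complex.normSq_eq_norm_sq, mul_one, norm_one] at e
  have h1 : 0 < (1 - ‖z‖ ^ 2) * (1 ^ 2 - ‖w‖ ^ 2) := by
    apply mul_pos <;> nlinarith [norm_nonneg z, norm_nonneg w]
  exact lt_of_pow_lt_pow_left₀ 2 (norm_nonneg _) (by linarith)

lemma differentiableAt_b {z w : ℂ} (hz : ‖z‖ < 1) (hw : ‖w‖ < 1) : DifferentiableAt ℂ (b z) w :=
  (by fun_prop : DifferentiableAt ℂ (fun w => w - z) w).div
    (by fun_prop : DifferentiableAt ℂ (fun w => 1 - conj z * w) w)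
    (one_sub_conj_mul_ne_zero hz hw.le)

/-- A form of the Schwarz lemma: a bound for `b z * h` on the disk is a bound for `h`. -/
lemma norm_le_of_norm_b_mul_le {h : ℂ → ℂ} (hd : DifferentiableOn ℂ h (Metric.ball 0 1)) {z : ℂ}
    (hz : ‖z‖ < 1) {C : ℝ} (hC : ∀ w : ℂ, ‖w‖ < 1 → ‖b z w * h w‖ ≤ C) :
    ∀ w : ℂ, ‖w‖ < 1 → ‖h w‖ ≤ C := by
  intro w hw
  have hC0 : 0 ≤ C := (norm_nonneg _).trans (hC 0 (by simp))
  have key : ∀ r : ℝ, max ‖w‖ ‖z‖ < r → r < 1 → ‖h w‖ ≤ C * (1 + (1 - r ^ 2) / (r - ‖z‖)) := by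
    intro r hr hr1
    have hrw : ‖w‖ < r := (le_max_left _ _).trans_lt hr
    have hrz : ‖z‖ < r := (le_max_right _ _).trans_lt hr
    have hr0 : 0 < r := (norm_nonneg _).trans_lt hrw
    refine Complex.norm_le_of_forall_mem_frontier_norm_le (U := Metric.ball 0 r)
      Metric.isBounded_ball ?_ ?_ (subset_closure (by simpa using hrw))
    · refine (hd.mono ?_).diffContOnCl
      rw [closure_ball _ hr0.ne']
      exact Metric.closedBall_subset_ball hr1
    · intro x hx
      rw [frontier_ball _ hr0.ne'] at hx
      have hx : ‖x‖ = r := by simpa using hx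
      have hxz : r - ‖z‖ ≤ ‖x - z‖ := hx ▸ norm_sub_norm_le x z
      have hpos : 0 < ‖x - z‖ := by linarith
      -- `1 - conj z * x` differs by `1 - r ^ 2` from the conjugate of `conj x * (x - z)`.
      have hden : ‖1 - conj z * x‖ ≤ ‖x - z‖ + (1 - r ^ 2) := by
        have e : 1 - conj z * x = x * conj (x - z) + ((1 - r ^ 2 : ℝ) : ℂ) := by
          rw [map_sub, mul_sub, Complex.mul_conj, Complex.normSq_eq_norm_sq, hx]
          push_cast; ring
        rw [e]
        refine (norm_add_le _ _).trans ?_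
        rw [norm_mul, RCLike.norm_conj, Complex.norm_real, Real.norm_of_nonneg (by nlinarith), hx]
        nlinarith
      have h0 := one_sub_conj_mul_ne_zero hz (hx.trans_lt hr1).le
      have h1 := hC x (hx.trans_lt hr1)
      rw [norm_mul, b, norm_div, div_mul_eq_mul_div, div_le_iff₀ (norm_pos_iff.mpr h0)] at h1
      have h2 : ‖h x‖ ≤ C * (1 + (1 - r ^ 2) / ‖x - z‖) := by
        have e : C * (1 + (1 - r ^ 2) / ‖x - z‖) = C * (‖x - z‖ + (1 - r ^ 2)) / ‖x - z‖ := by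
          field_simp
        rw [e, le_div_iff₀ hpos, mul_comm]
        exact h1.trans (by gcongr)
      refine h2.trans ?_
      have : 0 ≤ 1 - r ^ 2 := by nlinarith
      have : 0 < r - ‖z‖ := by linarith
      gcongr
  have hlim : Tendsto (fun r : ℝ => C * (1 + (1 - r ^ 2) / (r - ‖z‖))) (𝓝[<] 1) (𝓝 C) := by
    have : ContinuousAt (fun r : ℝ => C * (1 + (1 - r ^ 2) / (r - ‖z‖))) 1 := by
      have : (1 : ℝ) - ‖z‖ ≠ 0 := by linarith
      fun_prop (disch := assumption)
    simpa using this.tendsto.mono_left nhdsWithin_le_nhds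
  refine ge_of_tendsto hlim ?_
  filter_upwards [Ioo_mem_nhdsLT (max_lt hw hz)] with r hr using key r hr.1 hr.2

/-! ### Cauchy integrals on the circle -/

/-- The Cauchy integral `∫ e(t) / (t - w) dν(t)`. -/
noncomputable def cauchyInt (ν : Measure UnitCircle) (e : UnitCircle → ℂ) (w : ℂ) : ℂ :=
  ∫ t : UnitCircle, e t / ((t : ℂ) - w) ∂ν

lemma norm_coe_unitCircle (t : UnitCircle) : ‖(t : ℂ)‖ = 1 := by simp

lemma conj_mul_coe_unitCircle (t : UnitCircle) : conj (t : ℂ) * t = 1 := by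
  rw [Complex.conj_mul', norm_coe_unitCircle]; simp

lemma coe_unitCircle_sub_ne_zero (t : UnitCircle) {w : ℂ} (hw : ‖w‖ ≠ 1) : (t : ℂ) - w ≠ 0 :=
  fun h => hw (sub_eq_zero.mp h ▸ norm_coe_unitCircle t)

lemma integrable_of_continuous (ν : Measure UnitCircle) [IsFiniteMeasure ν] {e : UnitCircle → ℂ}
    (he : Continuous e) : Integrable e ν :=
  he.integrable_of_hasCompactSupport (HasCompactSupport.of_compactSpace e)

lemma integrable_cauchy (ν : Measure UnitCircle) [IsFiniteMeasure ν] {e : UnitCircle → ℂ}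
    (he : Continuous e) {w : ℂ} (hw : ‖w‖ ≠ 1) :
    Integrable (fun t : UnitCircle => e t / ((t : ℂ) - w)) ν :=
  integrable_of_continuous ν
    (he.div (by fun_prop) fun t => coe_unitCircle_sub_ne_zero t hw)

lemma cauchyInt_linear (ν : Measure UnitCircle) [IsFiniteMeasure ν] {e e' : UnitCircle → ℂ}
    (he : Continuous e) (he' : Continuous e') {w : ℂ} (hw : ‖w‖ ≠ 1) (x y : ℂ) :
    cauchyInt ν (fun t => x * e t + y * e' t) w
      = x * cauchyInt ν e w + y * cauchyInt ν e' w := by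
  simp only [cauchyInt]
  rw [← integral_const_mul, ← integral_const_mul, ← integral_add
    ((integrable_cauchy ν he hw).const_mul _) ((integrable_cauchy ν he' hw).const_mul _)]
  congr 1; ext t; ring

/-- A linear factor of the density can be taken out of a Cauchy integral at the cost of the plain
integral of the remaining factor. -/
lemma cauchyInt_affine_mul (ν : Measure UnitCircle) [IsFiniteMeasure ν] {e : UnitCircle → ℂ}
    (he : Continuous e) {w : ℂ} (hw : ‖w‖ ≠ 1) (x y : ℂ) :
    cauchyInt ν (fun t => (x + y * t) * e t) w
      = (x + y * w) * cauchyInt ν e w + y * ∫ t, e t ∂ν := by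
  simp only [cauchyInt]
  rw [← integral_const_mul, ← integral_const_mul, ← integral_add
    ((integrable_cauchy ν he hw).const_mul _) ((integrable_of_continuous ν he).const_mul _)]
  congr 1; ext t
  have := coe_unitCircle_sub_ne_zero t hw
  field_simp; ring

lemma differentiableOn_cauchyInt (ν : Measure UnitCircle) [IsFiniteMeasure ν]
    {e : UnitCircle → ℂ} (he : Continuous e) :
    DifferentiableOn ℂ (cauchyInt ν e) (Metric.ball 0 1) := by
  intro w hw
  have hw : ‖w‖ < 1 := by simpa using hw
  set δ : ℝ := (1 - ‖w‖) / 2 with hδ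
  have hδ0 : 0 < δ := by rw [hδ]; linarith
  have hsub : ∀ x ∈ Metric.ball w δ, ‖x‖ < 1 ∧ ∀ t : UnitCircle, δ ≤ ‖(t : ℂ) - x‖ := by
    intro x hx
    have hx : ‖x - w‖ < δ := by simpa [dist_eq_norm] using hx
    have h1 : ‖x‖ ≤ ‖x - w‖ + ‖w‖ := by simpa using norm_add_le (x - w) w
    refine ⟨by linarith, fun t => ?_⟩
    have h2 := norm_sub_norm_le (t : ℂ) x
    rw [norm_coe_unitCircle] at h2
    linarith
  have hcont : ∀ x : ℂ, ‖x‖ < 1 → Continuous fun t : UnitCircle => e t / ((t : ℂ) - x) :=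
    fun x hx => he.div (by fun_prop) fun t => coe_unitCircle_sub_ne_zero t hx.ne
  refine (hasDerivAt_integral_of_dominated_loc_of_deriv_le (Metric.ball_mem_nhds w hδ0)
    (F' := fun x (t : UnitCircle) => e t / ((t : ℂ) - x) ^ 2)
    (bound := fun t => ‖e t‖ / δ ^ 2) ?_ ?_ ?_ ?_ ?_ ?_).2.differentiableAt.differentiableWithinAt
  · filter_upwards [Metric.ball_mem_nhds w hδ0] with x hx
    exact (hcont x (hsub x hx).1).aestronglyMeasurable
  · exact integrable_of_continuous ν (hcont w hw)
  · exact (he.div (by fun_prop) fun t =>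
      pow_ne_zero 2 (coe_unitCircle_sub_ne_zero t hw.ne)).aestronglyMeasurable
  · refine ae_of_all _ fun t x hx => ?_
    rw [norm_div, norm_pow]
    have := (hsub x hx).2 t
    gcongr
  · exact (integrable_of_continuous ν he).norm.div_const _
  · refine ae_of_all _ fun t x hx => ?_
    have h0 := coe_unitCircle_sub_ne_zero t (hsub x hx).1.ne
    have h1 : HasDerivAt (fun x : ℂ => (t : ℂ) - x) (-1) x := (hasDerivAt_id x).const_sub _
    refine ((hasDerivAt_const x (e t)).div h1 h0).congr_deriv ?_
    ring

/-- The Carathéodory function as a Cauchy integral, from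
`(t + w) / (t - w) = 2 * t / (t - w) - 1`. -/
lemma caratheodory_add_one (ν : Measure UnitCircle) [IsProbabilityMeasure ν] {w : ℂ}
    (hw : ‖w‖ ≠ 1) : caratheodory ν w + 1 = 2 * cauchyInt ν (fun t => t) w := by
  have e : caratheodory ν w + 1 = ∫ t : UnitCircle, (((t : ℂ) + w) / ((t : ℂ) - w) + 1) ∂ν := by
    rw [integral_add (integrable_cauchy ν (by fun_prop) hw) (integrable_const _)]
    simp [caratheodory]
  rw [e, cauchyInt, ← integral_const_mul]
  congr 1; ext t
  have := coe_unitCircle_sub_ne_zero t hw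
  field_simp; ring

lemma caratheodory_sub_one (ν : Measure UnitCircle) [IsProbabilityMeasure ν] {w : ℂ}
    (hw : ‖w‖ ≠ 1) : caratheodory ν w - 1 = 2 * w * cauchyInt ν (fun _ => 1) w := by
  have e : caratheodory ν w - 1 = ∫ t : UnitCircle, (((t : ℂ) + w) / ((t : ℂ) - w) - 1) ∂ν := by
    rw [integral_sub (integrable_cauchy ν (by fun_prop) hw) (integrable_const _)]
    simp [caratheodory]
  rw [e, cauchyInt, ← integral_const_mul]
  congr 1; ext t
  have := coe_unitCircle_sub_ne_zero t hw
  field_simp; ring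

lemma caratheodory_re_nonneg (ν : Measure UnitCircle) [IsFiniteMeasure ν] {w : ℂ}
    (hw : ‖w‖ < 1) : 0 ≤ (caratheodory ν w).re := by
  have hi : Integrable (fun t : UnitCircle => ((t : ℂ) + w) / ((t : ℂ) - w)) ν :=
    integrable_cauchy ν (by fun_prop) hw.ne
  have e : (caratheodory ν w).re = ∫ t : UnitCircle, (((t : ℂ) + w) / ((t : ℂ) - w)).re ∂ν :=
    (integral_re hi).symm
  rw [e]
  refine integral_nonneg fun t => ?_
  have h1 : Complex.normSq (t : ℂ) = 1 := by
    rw [Complex.normSq_eq_norm_sq, norm_coe_unitCircle, one_pow]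
  have h2 : Complex.normSq w ≤ 1 := by
    rw [Complex.normSq_eq_norm_sq]; nlinarith [norm_nonneg w]
  rw [Complex.normSq_apply] at h1 h2
  simp only [Pi.zero_apply, Complex.div_re, Complex.add_re, Complex.add_im, Complex.sub_re,
    Complex.sub_im]
  rw [← add_div]
  exact div_nonneg (by nlinarith) (Complex.normSq_nonneg _)

lemma caratheodory_add_one_ne_zero (ν : Measure UnitCircle) [IsFiniteMeasure ν] {w : ℂ}
    (hw : ‖w‖ < 1) : caratheodory ν w + 1 ≠ 0 := by
  intro h
  have h1 := congrArg Complex.re h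
  have h2 := caratheodory_re_nonneg ν hw
  simp only [Complex.add_re, Complex.one_re, Complex.zero_re] at h1
  linarith

lemma norm_caratheodory_sub_one_le (ν : Measure UnitCircle) [IsFiniteMeasure ν] {w : ℂ}
    (hw : ‖w‖ < 1) : ‖caratheodory ν w - 1‖ ≤ ‖caratheodory ν w + 1‖ := by
  have h2 := caratheodory_re_nonneg ν hw
  refine (sq_le_sq₀ (norm_nonneg _) (norm_nonneg _)).mp ?_
  rw [← Complex.normSq_eq_norm_sq, ← Complex.normSq_eq_norm_sq]
  simp only [Complex.normSq_apply, Complex.add_re, Complex.add_im, Complex.sub_re,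
    Complex.sub_im, Complex.one_re, Complex.one_im]
  nlinarith

/-! ### The multipoint Schur algorithm -/

/-- `f` is a sequence of iterates of the multipoint Schur algorithm with nodes `z 1, z 2, …` and
parameters `a 0, a 1, …`: analytic functions from the disk to the closed disk with
`f k = (a k + b (z (k + 1)) * f (k + 1)) / (1 + conj (a k) * b (z (k + 1)) * f (k + 1))`,
written without division. -/
structure IsSchurIterates (z a : ℕ → ℂ) (f : ℕ → ℂ → ℂ) : Prop where
  diff : ∀ k, DifferentiableOn ℂ (f k) (Metric.ball 0 1)
  bound : ∀ k w, ‖w‖ < 1 → ‖f k w‖ ≤ 1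
  step : ∀ k w, ‖w‖ < 1 →
    f k w * (1 + conj (a k) * (b (z (k + 1)) w * f (k + 1) w))
      = a k + b (z (k + 1)) w * f (k + 1) w

namespace IsSchurIterates

variable {z a : ℕ → ℂ} {f g : ℕ → ℂ → ℂ}

lemma shift (h : IsSchurIterates z a f) (n : ℕ) :
    IsSchurIterates (fun k => z (k + n)) (fun k => a (k + n)) fun k => f (k + n) where
  diff k := h.diff _
  bound k := h.bound _
  step k w hw := by
    have := h.step (k + n) w hw
    rwa [Nat.add_right_comm k n 1] at this

/-- Rotating all iterates rotates all parameters. -/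
lemma const_mul (h : IsSchurIterates z a f) {u : ℂ} (hu : ‖u‖ = 1) :
    IsSchurIterates z (fun k => u * a k) fun k w => u * f k w where
  diff k := (h.diff k).const_mul u
  bound k w hw := by simpa [hu] using h.bound k w hw
  step k w hw := by
    have hu' : conj u * u = 1 := by rw [Complex.conj_mul', hu]; simp
    have := h.step k w hw
    simp only [map_mul]
    linear_combination u * this
      + u * f k w * conj (a k) * b (z (k + 1)) w * f (k + 1) w * hu'

lemma denom_ne_zero (hz : ∀ k, ‖z k‖ < 1) (ha : ∀ k, ‖a k‖ < 1) (h : IsSchurIterates z a f)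
    (k : ℕ) {w : ℂ} (hw : ‖w‖ < 1) :
    1 + conj (a k) * (b (z (k + 1)) w * f (k + 1) w) ≠ 0 := by
  have h1 := one_sub_conj_mul_ne_zero (ha k) (w := -(b (z (k + 1)) w * f (k + 1) w)) (by
    rw [norm_neg, norm_mul]
    exact mul_le_one₀ (norm_b_lt_one (hz _) hw).le (norm_nonneg _) (h.bound _ w hw))
  rwa [mul_neg, sub_neg_eq_add] at h1

/-- Two functions with the same nodes and the same first `n` parameters differ by a multiple of
the Blaschke product of the first `n` nodes. The multiplier `u` carries the factors that arise
when the algorithm is run; the Schwarz lemma keeps the bound `2` at each step. -/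
lemma norm_sub_le_prod (n : ℕ) : ∀ {z a : ℕ → ℂ} {f g : ℕ → ℂ → ℂ}, (∀ k, ‖z k‖ < 1) →
    (∀ k, ‖a k‖ < 1) → IsSchurIterates z a f → IsSchurIterates z a g → ∀ {u : ℂ → ℂ},
    DifferentiableOn ℂ u (Metric.ball 0 1) →
    (∀ w : ℂ, ‖w‖ < 1 → ‖u w * (f 0 w - g 0 w)‖ ≤ 2) →
    ∀ w : ℂ, ‖w‖ < 1 →
      ‖u w * (f 0 w - g 0 w)‖ ≤ 2 * ∏ j ∈ Finset.range n, ‖b (z (j + 1)) w‖ := by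
  induction n with
  | zero => intro z a f g _ _ _ _ u _ hb w hw; simpa using hb w hw
  | succ n ih =>
    intro z a f g hz ha hf hg u hu hb w hw
    set df := fun w => 1 + conj (a 0) * (b (z 1) w * f 1 w)
    set dg := fun w => 1 + conj (a 0) * (b (z 1) w * g 1 w)
    have hdf0 : ∀ w : ℂ, ‖w‖ < 1 → df w ≠ 0 := fun w hw => hf.denom_ne_zero hz ha 0 hw
    have hdg0 : ∀ w : ℂ, ‖w‖ < 1 → dg w ≠ 0 := fun w hw => hg.denom_ne_zero hz ha 0 hw
    have hbd : DifferentiableOn ℂ (b (z 1)) (Metric.ball 0 1) := fun w hw =>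
      (differentiableAt_b (hz 1) (by simpa using hw)).differentiableWithinAt
    set v := fun w => u w * (1 - conj (a 0) * a 0) / (df w * dg w) with hv
    have hvd : DifferentiableOn ℂ v (Metric.ball 0 1) := by
      refine (hu.mul_const _).div (((hbd.mul (hf.diff 1)).const_mul _ |>.const_add _).mul
        ((hbd.mul (hg.diff 1)).const_mul _ |>.const_add _)) fun w hw => ?_
      have hw : ‖w‖ < 1 := by simpa using hw
      exact mul_ne_zero (hdf0 w hw) (hdg0 w hw)
    have hrel : ∀ w : ℂ, ‖w‖ < 1 →
        u w * (f 0 w - g 0 w) = b (z 1) w * (v w * (f 1 w - g 1 w)) := by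
      intro w hw
      have h1 : f 0 w * df w = a 0 + b (z 1) w * f 1 w := hf.step 0 w hw
      have h2 : g 0 w * dg w = a 0 + b (z 1) w * g 1 w := hg.step 0 w hw
      have h3 := hdf0 w hw
      have h4 := hdg0 w hw
      have e : (f 0 w - g 0 w) * (df w * dg w)
          = (1 - conj (a 0) * a 0) * (b (z 1) w * (f 1 w - g 1 w)) := by
        have e1 : df w = 1 + conj (a 0) * (b (z 1) w * f 1 w) := rfl
        have e2 : dg w = 1 + conj (a 0) * (b (z 1) w * g 1 w) := rfl
        linear_combination dg w * h1 - df w * h2 - (a 0 + b (z 1) w * g 1 w) * e1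
          + (a 0 + b (z 1) w * f 1 w) * e2
      rw [hv]
      field_simp
      linear_combination u w * e
    have hb' : ∀ w : ℂ, ‖w‖ < 1 → ‖v w * (f 1 w - g 1 w)‖ ≤ 2 :=
      norm_le_of_norm_b_mul_le (hvd.mul ((hf.diff 1).sub (hg.diff 1))) (hz 1) fun w hw => by
        have := hb w hw
        rw [hrel w hw] at this
        exact this
    have h1 := ih (fun k => hz (k + 1)) (fun k => ha (k + 1)) (hf.shift 1) (hg.shift 1) hvd hb' w hw
    rw [hrel w hw, norm_mul, Finset.prod_range_succ']
    calc ‖b (z 1) w‖ * ‖v w * (f 1 w - g 1 w)‖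
        ≤ ‖b (z 1) w‖ * (2 * ∏ j ∈ Finset.range n, ‖b (z (j + 1 + 1)) w‖) := by gcongr
      _ = _ := by ring

/-- For periodic nodes a function is determined by its Schur parameters: the Blaschke products of
the nodes tend to zero. -/
lemma unique {p : ℕ} (hp : 1 ≤ p) (hz : ∀ k, ‖z k‖ < 1) (hzp : ∀ k, z (k + p) = z k)
    (ha : ∀ k, ‖a k‖ < 1) (hf : IsSchurIterates z a f) (hg : IsSchurIterates z a g) {w : ℂ}
    (hw : ‖w‖ < 1) : f 0 w = g 0 w := by
  have hb : ∀ w : ℂ, ‖w‖ < 1 → ‖(1 : ℂ) * (f 0 w - g 0 w)‖ ≤ 2 := by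
    intro w hw
    rw [one_mul]
    have h1 := hf.bound 0 w hw
    have h2 := hg.bound 0 w hw
    exact (norm_sub_le _ _).trans (by linarith)
  obtain ⟨j, -, hj⟩ := Finset.exists_max_image (Finset.range p) (fun j => ‖b (z j) w‖)
    ⟨0, Finset.mem_range.mpr hp⟩
  set r := ‖b (z j) w‖
  have hr1 : r < 1 := norm_b_lt_one (hz j) hw
  have hle : ∀ k, ‖b (z k) w‖ ≤ r := fun k => by
    rw [← (show Function.Periodic z p from hzp).map_mod_nat k]
    exact hj _ (Finset.mem_range.mpr (Nat.mod_lt _ hp))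
  have hbound : ∀ n : ℕ, ‖f 0 w - g 0 w‖ ≤ 2 * r ^ n := by
    intro n
    have h1 := norm_sub_le_prod n hz ha hf hg (u := fun _ => 1) (differentiableOn_const 1) hb w hw
    rw [one_mul] at h1
    refine h1.trans ?_
    have h2 : ∏ j ∈ Finset.range n, ‖b (z (j + 1)) w‖ ≤ ∏ _j ∈ Finset.range n, r :=
      Finset.prod_le_prod (fun _ _ => norm_nonneg _) fun _ _ => hle _
    rw [Finset.prod_const, Finset.card_range] at h2
    linarith
  have hlim : Tendsto (fun n : ℕ => 2 * r ^ n) atTop (𝓝 0) := by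
    simpa using (tendsto_pow_atTop_nhds_zero_of_lt_one (norm_nonneg _) hr1).const_mul 2
  exact sub_eq_zero.mp (norm_le_zero_iff.mp (ge_of_tendsto' hlim hbound))

/-- The algorithm in projective form. -/
lemma exists_smul (hz : ∀ k, ‖z k‖ < 1) (ha : ∀ k, ‖a k‖ < 1) (h : IsSchurIterates z a f)
    {w : ℂ} (hw : ‖w‖ < 1) (n : ℕ) :
    ∃ c : ℂ, c ≠ 0 ∧ ![f 0 w, 1]
      = c • (((List.range n).map fun k => U (a k) * D (z (k + 1)) w).prod.mulVec ![f n w, 1]) := by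
  induction n with
  | zero => exact ⟨1, one_ne_zero, by simp⟩
  | succ n ih =>
    obtain ⟨c, hc, e⟩ := ih
    have h0 := h.denom_ne_zero hz ha n hw
    have hρ : ((Real.sqrt (1 - ‖a n‖ ^ 2) : ℝ) : ℂ) ≠ 0 := by
      have := ha n
      exact_mod_cast (Real.sqrt_pos.mpr (by nlinarith [norm_nonneg (a n)])).ne'
    have hs := h.step n w hw
    obtain ⟨q, hq⟩ : ∃ q, q = 1 + conj (a n) * (b (z (n + 1)) w * f (n + 1) w) := ⟨_, rfl⟩
    rw [← hq] at h0 hs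
    refine ⟨c * ((Real.sqrt (1 - ‖a n‖ ^ 2) : ℝ) / q), mul_ne_zero hc (div_ne_zero hρ h0), ?_⟩
    rw [List.range_succ, List.map_append, List.prod_append, e]
    simp only [List.map_cons, List.map_nil, List.prod_cons, List.prod_nil, mul_one]
    rw [mul_smul, ← Matrix.mulVec_mulVec, ← Matrix.mulVec_smul _ (_ / q)]
    congr 2
    ext i
    fin_cases i
    · simp [U, D]
      field_simp
      linear_combination hs
    · simp [U, D]
      field_simp
      linear_combination hq

end IsSchurIterates

/-! ### Numerators and denominators of the rational functions -/

/-- The constant `η_{k+1} / (η_k ρ_k)` of the recurrence, with `ρ_k = (1 - |a_k|²)^(1/2)`. -/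
noncomputable def stepConst (z a : ℕ → ℂ) (k : ℕ) : ℂ :=
  eta (z (k + 1)) / eta (z k) * ((1 / Real.sqrt (1 - ‖a k‖ ^ 2) : ℝ) : ℂ)

/-- The pair of numerators generated by the recurrence from the initial values `1` and `ε`. For
`ε = 1` these are the numerators of `φ_k` and `φ_k^*`, for `ε = -1` those of `ψ_k` and `-ψ_k^*`. -/
noncomputable def numPair (z a : ℕ → ℂ) (ε : ℂ) : ℕ → Polynomial ℂ × Polynomial ℂ
  | 0 => (1, Polynomial.C ε)
  | k + 1 =>
      (Polynomial.C (stepConst z a k) * ((Polynomial.X - Polynomial.C (z k)) * (numPair z a ε k).1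
        - Polynomial.C (conj (a k)) * ((1 - Polynomial.C (conj (z k)) * Polynomial.X)
          * (numPair z a ε k).2)),
       Polynomial.C (stepConst z a k) * ((1 - Polynomial.C (conj (z k)) * Polynomial.X)
          * (numPair z a ε k).2
        - Polynomial.C (a k) * ((Polynomial.X - Polynomial.C (z k)) * (numPair z a ε k).1)))

/-- The common denominator `∏_{j=1}^k (1 - conj (z_j) X)`. -/
noncomputable def den (z : ℕ → ℂ) (k : ℕ) : Polynomial ℂ :=
  ∏ j ∈ Finset.Icc 1 k, (1 - Polynomial.C (conj (z j)) * Polynomial.X)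

section values

variable (z a : ℕ → ℂ) (ε : ℂ)

lemma eval_den_succ (k : ℕ) (w : ℂ) :
    (den z (k + 1)).eval w = (den z k).eval w * (1 - conj (z (k + 1)) * w) := by
  simp [den, Finset.prod_Icc_succ_top]

lemma eval_numPair_succ_fst (k : ℕ) (w : ℂ) :
    (numPair z a ε (k + 1)).1.eval w
      = stepConst z a k * ((w - z k) * (numPair z a ε k).1.eval w
        - conj (a k) * ((1 - conj (z k) * w) * (numPair z a ε k).2.eval w)) := by
  simp [numPair]

lemma eval_numPair_succ_snd (k : ℕ) (w : ℂ) :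
    (numPair z a ε (k + 1)).2.eval w
      = stepConst z a k * ((1 - conj (z k) * w) * (numPair z a ε k).2.eval w
        - a k * ((w - z k) * (numPair z a ε k).1.eval w)) := by
  simp [numPair]

/-- The value of `φ_k` at `w`. -/
noncomputable def phiVal (k : ℕ) (w : ℂ) : ℂ := (numPair z a 1 k).1.eval w / (den z k).eval w

/-- The value of `φ_k^*` at `w`. -/
noncomputable def phiStarVal (k : ℕ) (w : ℂ) : ℂ := (numPair z a 1 k).2.eval w / (den z k).eval w

variable {z a ε}

lemma sqrt_one_sub_sq_ne_zero {w : ℂ} (hw : ‖w‖ < 1) : Real.sqrt (1 - ‖w‖ ^ 2) ≠ 0 :=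
  (Real.sqrt_pos.mpr (by nlinarith [norm_nonneg w])).ne'

lemma eta_ne_zero {w : ℂ} (hw : ‖w‖ < 1) : eta w ≠ 0 :=
  Complex.ofReal_ne_zero.mpr (sqrt_one_sub_sq_ne_zero hw)

lemma stepConst_ne_zero (hz : ∀ k, ‖z k‖ < 1) (ha : ∀ k, ‖a k‖ < 1) (k : ℕ) :
    stepConst z a k ≠ 0 :=
  mul_ne_zero (div_ne_zero (eta_ne_zero (hz _)) (eta_ne_zero (hz _)))
    (Complex.ofReal_ne_zero.mpr (one_div_ne_zero (sqrt_one_sub_sq_ne_zero (ha k))))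

lemma conj_stepConst (k : ℕ) : conj (stepConst z a k) = stepConst z a k := by
  simp [stepConst, eta]

lemma eval_den_ne_zero (k : ℕ) {w : ℂ} (hw : ∀ k, 1 - conj (z k) * w ≠ 0) :
    (den z k).eval w ≠ 0 := by
  rw [den, Polynomial.eval_prod, Finset.prod_ne_zero_iff]
  intro j _
  simpa using hw j

lemma phiVal_succ (hz : ∀ k, ‖z k‖ < 1) (k : ℕ) {w : ℂ} (hw : ‖w‖ ≤ 1) :
    (1 - conj (z (k + 1)) * w) * phiVal z a (k + 1) w
      = stepConst z a k * ((w - z k) * phiVal z a k w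
        - conj (a k) * ((1 - conj (z k) * w) * phiStarVal z a k w)) := by
  have h := fun k => one_sub_conj_mul_ne_zero (hz k) hw
  have h1 := eval_den_ne_zero k h
  have h2 := h (k + 1)
  rw [phiVal, phiVal, phiStarVal, eval_den_succ, eval_numPair_succ_fst]
  field_simp

lemma phiStarVal_succ (hz : ∀ k, ‖z k‖ < 1) (k : ℕ) {w : ℂ} (hw : ‖w‖ ≤ 1) :
    (1 - conj (z (k + 1)) * w) * phiStarVal z a (k + 1) w
      = stepConst z a k * ((1 - conj (z k) * w) * phiStarVal z a k w
        - a k * ((w - z k) * phiVal z a k w)) := by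
  have h := fun k => one_sub_conj_mul_ne_zero (hz k) hw
  have h1 := eval_den_ne_zero k h
  have h2 := h (k + 1)
  rw [phiVal, phiStarVal, phiStarVal, eval_den_succ, eval_numPair_succ_snd]
  field_simp

lemma continuous_phiVal (hz : ∀ k, ‖z k‖ < 1) (k : ℕ) :
    Continuous fun t : UnitCircle => phiVal z a k t :=
  ((Polynomial.continuous _).comp continuous_subtype_val).div
    ((Polynomial.continuous _).comp continuous_subtype_val) fun t =>
      eval_den_ne_zero k fun k => one_sub_conj_mul_ne_zero (hz k) (norm_coe_unitCircle t).le

lemma continuous_phiStarVal (hz : ∀ k, ‖z k‖ < 1) (k : ℕ) :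
    Continuous fun t : UnitCircle => phiStarVal z a k t :=
  ((Polynomial.continuous _).comp continuous_subtype_val).div
    ((Polynomial.continuous _).comp continuous_subtype_val) fun t =>
      eval_den_ne_zero k fun k => one_sub_conj_mul_ne_zero (hz k) (norm_coe_unitCircle t).le

/-- Outside the closed disk `φ_k` dominates `φ_k^*`, so that the numerator of `φ_k` has no zero
there. -/
lemma numPair_fst_ne_zero (hz : ∀ k, ‖z k‖ < 1) (ha : ∀ k, ‖a k‖ < 1) {w : ℂ} (hw : 1 < ‖w‖)
    (k : ℕ) : (numPair z a 1 k).1.eval w ≠ 0 ∧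
      ‖(numPair z a 1 k).2.eval w‖ ≤ ‖(numPair z a 1 k).1.eval w‖ := by
  induction k with
  | zero => simp [numPair]
  | succ k ih =>
    obtain ⟨h0, h1⟩ := ih
    have hlt : ‖1 - conj (z k) * w‖ < ‖w - z k‖ := by
      have e := normSq_sub_conj_mul (z k) 1 w
      simp only [Complex.normSq_eq_norm_sq, mul_one, norm_one] at e
      have h1 : 0 < (1 - ‖z k‖ ^ 2) * (‖w‖ ^ 2 - 1) := by
        have := hz k
        apply mul_pos <;> nlinarith [norm_nonneg (z k)]
      exact lt_of_pow_lt_pow_left₀ 2 (norm_nonneg _) (by nlinarith)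
    rw [eval_numPair_succ_fst, eval_numPair_succ_snd]
    set x := (w - z k) * (numPair z a 1 k).1.eval w with hx
    set y := (1 - conj (z k) * w) * (numPair z a 1 k).2.eval w with hy
    have hxy : ‖y‖ < ‖x‖ := by
      rw [hx, hy, norm_mul, norm_mul]
      exact (mul_le_mul_of_nonneg_left h1 (norm_nonneg _)).trans_lt
        (mul_lt_mul_of_pos_right hlt (norm_pos_iff.mpr h0))
    constructor
    · refine mul_ne_zero (stepConst_ne_zero hz ha k) fun h => ?_
      have h2 : ‖x‖ ≤ ‖y‖ := by
        rw [sub_eq_zero.mp h, norm_mul, RCLike.norm_conj]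
        exact mul_le_of_le_one_left (norm_nonneg _) (ha k).le
      exact absurd hxy (not_lt.mpr h2)
    · rw [norm_mul, norm_mul]
      exact mul_le_mul_of_nonneg_left (norm_sub_mul_le (ha k) hxy.le) (norm_nonneg _)

end values

/-! ### Reversal in the field of rational functions -/

/-- `X⁻¹` is transcendental over `ℂ`, so the substitution in `sharp` kills no denominator. -/
lemma eval₂_conj_X_inv_ne_zero {q : Polynomial ℂ} (hq : q ≠ 0) :
    q.eval₂ ((RatFunc.C : ℂ →+* RatFunc ℂ).comp (starRingEnd ℂ)) (RatFunc.X)⁻¹ ≠ 0 := by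
  intro h
  have hX : Transcendental ℂ (RatFunc.X : RatFunc ℂ) := RatFunc.transcendental_X
  have h1 : Transcendental ℂ ((RatFunc.X : RatFunc ℂ)⁻¹) := fun h => hX (by simpa using h.inv)
  rw [← Polynomial.eval₂_map] at h
  have h2 := transcendental_iff.mp h1 (q.map (starRingEnd ℂ)) h
  exact hq ((Polynomial.map_eq_zero _).mp h2)

lemma nonZeroDivisors_le_comap_eval₂_conj :
    nonZeroDivisors (Polynomial ℂ) ≤ (nonZeroDivisors (RatFunc ℂ)).comap
      (Polynomial.eval₂RingHom ((RatFunc.C : ℂ →+* RatFunc ℂ).comp (starRingEnd ℂ))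
        (RatFunc.X)⁻¹) :=
  fun _ hq => mem_nonZeroDivisors_of_ne_zero
    (eval₂_conj_X_inv_ne_zero (nonZeroDivisors.ne_zero hq))

/-- The map `sharp` as a ring homomorphism. -/
noncomputable def sharpHom : RatFunc ℂ →+* RatFunc ℂ :=
  RatFunc.liftRingHom
    (Polynomial.eval₂RingHom ((RatFunc.C : ℂ →+* RatFunc ℂ).comp (starRingEnd ℂ)) (RatFunc.X)⁻¹)
    nonZeroDivisors_le_comap_eval₂_conj

lemma sharp_eq (f : RatFunc ℂ) : sharp f = sharpHom f := by
  conv_rhs => rw [← RatFunc.num_div_denom f]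
  rw [sharpHom, RatFunc.liftRingHom_apply_div]
  rfl

lemma sharpHom_C (c : ℂ) : sharpHom (RatFunc.C c) = RatFunc.C (conj c) := by
  rw [← sharp_eq]; simp [sharp]

lemma sharpHom_X : sharpHom RatFunc.X = RatFunc.X⁻¹ := by
  rw [← sharp_eq]; simp [sharp]

lemma one_sub_C_mul_X_ne_zero (c : ℂ) : (1 - RatFunc.C c * RatFunc.X : RatFunc ℂ) ≠ 0 := by
  have e : (1 - RatFunc.C c * RatFunc.X : RatFunc ℂ)
      = algebraMap _ _ (1 - Polynomial.C c * Polynomial.X : Polynomial ℂ) := by simp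
  rw [e]
  refine RatFunc.algebraMap_ne_zero fun h => ?_
  simpa using congrArg (Polynomial.eval 0) h

lemma X_sub_C_ne_zero (c : ℂ) : (RatFunc.X - RatFunc.C c : RatFunc ℂ) ≠ 0 := by
  have e : (RatFunc.X - RatFunc.C c : RatFunc ℂ)
      = algebraMap _ _ (Polynomial.X - Polynomial.C c : Polynomial ℂ) := by simp
  rw [e]
  exact RatFunc.algebraMap_ne_zero (Polynomial.X_sub_C_ne_zero c)

lemma bRat_ne_zero (w : ℂ) : bRat w ≠ 0 :=
  div_ne_zero (X_sub_C_ne_zero w) (one_sub_C_mul_X_ne_zero _)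

/-- The reversal of `1 - conj c * X`, cleared of the inner inverse. -/
lemma one_sub_C_mul_X_inv (c : ℂ) :
    (1 - RatFunc.C c * RatFunc.X⁻¹ : RatFunc ℂ) = (RatFunc.X - RatFunc.C c) * RatFunc.X⁻¹ := by
  have := RatFunc.X_ne_zero (K := ℂ)
  field_simp

lemma sharpHom_bRat (w : ℂ) : sharpHom (bRat w) = (bRat w)⁻¹ := by
  have h1 := one_sub_C_mul_X_ne_zero (conj w)
  have h2 := X_sub_C_ne_zero w
  have h3 := RatFunc.X_ne_zero (K := ℂ)
  simp only [bRat, map_div₀, map_sub, map_mul, map_one, sharpHom_X, sharpHom_C,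
    Complex.conj_conj, one_sub_C_mul_X_inv]
  field_simp

/-- The rational factor of the prefactor is compatible with reversal:
`b_{z_{k+1}} * prefactor^# = prefactor * b_{z_k}`. -/
lemma bRat_mul_sharpHom_prefactor (z : ℕ → ℂ) (k : ℕ) :
    bRat (z (k + 1)) * sharpHom (prefactor z k) = prefactor z k * bRat (z k) := by
  have h1 := one_sub_C_mul_X_ne_zero (conj (z k))
  have h2 := one_sub_C_mul_X_ne_zero (conj (z (k + 1)))
  have h3 := X_sub_C_ne_zero (z (k + 1))
  have h4 := RatFunc.X_ne_zero (K := ℂ)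
  have h5 : conj (eta (z (k + 1)) / eta (z k)) = eta (z (k + 1)) / eta (z k) := by simp [eta]
  rw [prefactor]
  generalize eta (z (k + 1)) / eta (z k) = c at *
  simp only [bRat, map_div₀, map_sub, map_mul, map_one, sharpHom_X, sharpHom_C,
    Complex.conj_conj, one_sub_C_mul_X_inv, h5]
  generalize 1 - RatFunc.C (conj (z k)) * RatFunc.X = u at *
  generalize 1 - RatFunc.C (conj (z (k + 1))) * RatFunc.X = v at *
  field_simp

/-- The rational function with numerator `(numPair z a ε k).1`. -/
noncomputable def fstRat (z a : ℕ → ℂ) (ε : ℂ) (k : ℕ) : RatFunc ℂ :=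
  algebraMap _ _ (numPair z a ε k).1 / algebraMap _ _ (den z k)

/-- The rational function with numerator `(numPair z a ε k).2`. -/
noncomputable def sndRat (z a : ℕ → ℂ) (ε : ℂ) (k : ℕ) : RatFunc ℂ :=
  algebraMap _ _ (numPair z a ε k).2 / algebraMap _ _ (den z k)

section rational

variable (z a : ℕ → ℂ) (ε : ℂ)

lemma den_ne_zero (k : ℕ) : den z k ≠ 0 := by
  intro h
  have h1 := congrArg (Polynomial.eval 0) h
  simp [den, Polynomial.eval_prod] at h1

lemma den_succ (k : ℕ) :
    den z (k + 1) = den z k * (1 - Polynomial.C (conj (z (k + 1))) * Polynomial.X) := by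
  simp [den, Finset.prod_Icc_succ_top]

/-- The first row of the recurrence, with the scalar of `U (-conj a_k)` taken out. -/
lemma fstRat_succ (k : ℕ) :
    fstRat z a ε (k + 1) = prefactor z k * RatFunc.C ((1 / Real.sqrt (1 - ‖a k‖ ^ 2) : ℝ) : ℂ)
      * (bRat (z k) * fstRat z a ε k - RatFunc.C (conj (a k)) * sndRat z a ε k) := by
  have h1 := one_sub_C_mul_X_ne_zero (conj (z k))
  have h2 := one_sub_C_mul_X_ne_zero (conj (z (k + 1)))
  have h3 : algebraMap (Polynomial ℂ) (RatFunc ℂ) (den z k) ≠ 0 :=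
    RatFunc.algebraMap_ne_zero (den_ne_zero z k)
  simp only [fstRat, sndRat, numPair, den_succ, prefactor, bRat, stepConst, map_mul, map_sub,
    map_one, RatFunc.algebraMap_C, RatFunc.algebraMap_X]
  generalize 1 - RatFunc.C (conj (z k)) * RatFunc.X = u at *
  generalize 1 - RatFunc.C (conj (z (k + 1))) * RatFunc.X = v at *
  field_simp

lemma sndRat_succ (k : ℕ) :
    sndRat z a ε (k + 1) = prefactor z k * RatFunc.C ((1 / Real.sqrt (1 - ‖a k‖ ^ 2) : ℝ) : ℂ)
      * (sndRat z a ε k - RatFunc.C (a k) * (bRat (z k) * fstRat z a ε k)) := by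
  have h1 := one_sub_C_mul_X_ne_zero (conj (z k))
  have h2 := one_sub_C_mul_X_ne_zero (conj (z (k + 1)))
  have h3 : algebraMap (Polynomial ℂ) (RatFunc ℂ) (den z k) ≠ 0 :=
    RatFunc.algebraMap_ne_zero (den_ne_zero z k)
  simp only [fstRat, sndRat, numPair, den_succ, prefactor, bRat, stepConst, map_mul, map_sub,
    map_one, RatFunc.algebraMap_C, RatFunc.algebraMap_X]
  generalize 1 - RatFunc.C (conj (z k)) * RatFunc.X = u at *
  generalize 1 - RatFunc.C (conj (z (k + 1))) * RatFunc.X = v at *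
  field_simp

variable {ε}

/-- The recurrence preserves the relation that the two components are reversed to each other up
to the sign `ε`. -/
lemma bProd_mul_sharpHom (hε : ε * ε = 1) (hε' : conj ε = ε) (k : ℕ) :
    bProd z k * sharpHom (fstRat z a ε k) = RatFunc.C ε * sndRat z a ε k ∧
      bProd z k * sharpHom (sndRat z a ε k) = RatFunc.C ε * fstRat z a ε k := by
  have hC : RatFunc.C ε * RatFunc.C ε = 1 := by rw [← map_mul, hε, map_one]
  induction k with
  | zero =>
    constructor
    · simp [bProd, fstRat, sndRat, numPair, den, hC]
    · simp [bProd, fstRat, sndRat, numPair, den, sharpHom_C, hε']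
  | succ k ih =>
    obtain ⟨ih1, ih2⟩ := ih
    have hb := bRat_ne_zero (z k)
    have hp := bRat_mul_sharpHom_prefactor z k
    have hB : bProd z (k + 1) = bProd z k * bRat (z (k + 1)) := by
      simp [bProd, Finset.prod_Icc_succ_top]
    have hbb : bRat (z k) * (bRat (z k))⁻¹ = 1 := mul_inv_cancel₀ hb
    rw [fstRat_succ, sndRat_succ, hB]
    simp only [map_mul, map_sub, sharpHom_C, sharpHom_bRat, Complex.conj_conj, Complex.conj_ofReal]
    obtain ⟨r, hr⟩ : ∃ r : RatFunc ℂ, r = RatFunc.C ((1 / Real.sqrt (1 - ‖a k‖ ^ 2) : ℝ) : ℂ) :=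
      ⟨_, rfl⟩
    rw [← hr]
    constructor
    · linear_combination
        (bProd z k * r * ((bRat (z k))⁻¹ * sharpHom (fstRat z a ε k)
          - RatFunc.C (a k) * sharpHom (sndRat z a ε k))) * hp
        + prefactor z k * r * bRat (z k) * (bRat (z k))⁻¹ * ih1
        - prefactor z k * r * bRat (z k) * RatFunc.C (a k) * ih2
        + prefactor z k * r * RatFunc.C ε * sndRat z a ε k * hbb
    · linear_combination
        (bProd z k * r * (sharpHom (sndRat z a ε k)
          - RatFunc.C (conj (a k)) * ((bRat (z k))⁻¹ * sharpHom (fstRat z a ε k)))) * hp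
        + prefactor z k * r * bRat (z k) * ih2
        - prefactor z k * r * bRat (z k) * (bRat (z k))⁻¹ * RatFunc.C (conj (a k)) * ih1
        - prefactor z k * r * RatFunc.C (conj (a k)) * RatFunc.C ε * sndRat z a ε k * hbb

lemma rev_fstRat_one (k : ℕ) : rev z k (fstRat z a 1 k) = sndRat z a 1 k := by
  rw [rev, sharp_eq, (bProd_mul_sharpHom z a (by norm_num) (by simp) k).1]; simp

lemma rev_fstRat_neg_one (k : ℕ) : rev z k (fstRat z a (-1) k) = -sndRat z a (-1) k := by
  rw [rev, sharp_eq, (bProd_mul_sharpHom z a (by norm_num) (by simp) k).1]; simp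

/-- The functions defined by the first row of the recurrence and reversal agree with those
generated by both rows. -/
lemma phi_eq_fstRat (k : ℕ) : phi z a k = fstRat z a 1 k := by
  induction k with
  | zero => simp [phi, fstRat, numPair, den]
  | succ k ih =>
    rw [phi, ih, rev_fstRat_one, fstRat_succ]
    simp [U]
    ring

end rational

lemma ev_div (p q : Polynomial ℂ) {w : ℂ} (hw : q.eval w ≠ 0) :
    ev (algebraMap _ _ p / algebraMap _ _ q) w = p.eval w / q.eval w := by
  set f : RatFunc ℂ := algebraMap _ _ p / algebraMap _ _ q with hf
  have hq : q ≠ 0 := fun h => hw (by simp [h])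
  have hd : f.denom.eval w ≠ 0 := fun h =>
    hw (Polynomial.eval_eq_zero_of_dvd_of_eval_eq_zero (RatFunc.denom_div_dvd p q) h)
  have e := congrArg (Polynomial.eval w) ((RatFunc.num_mul_eq_mul_denom_iff hq).mpr hf)
  rw [ev, RatFunc.eval, Polynomial.eval₂_id, Polynomial.eval₂_id, div_eq_div_iff hd hw]
  simpa using e

/-! ### Consequences of orthogonality -/

section measure

variable {z a : ℕ → ℂ} {ν : Measure UnitCircle}

lemma ev_phi (k : ℕ) {w : ℂ} (hw : (den z k).eval w ≠ 0) :
    ev (phi z a k) w = phiVal z a k w := by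
  rw [phi_eq_fstRat, fstRat, ev_div _ _ hw, phiVal]

/-- The mean of `φ_k`, from orthogonality to `φ_0 = 1`. It is the only consequence of
orthonormality that the argument uses. -/
lemma integral_phiVal (hz : ∀ k, ‖z k‖ < 1) (hν : IsOrthogonalityMeasure ν (phi z a)) (k : ℕ) :
    ∫ t : UnitCircle, phiVal z a k t ∂ν = if k = 0 then 1 else 0 := by
  rw [← hν k 0]
  congr 1; ext t
  rw [ev_phi k (eval_den_ne_zero k fun k =>
    one_sub_conj_mul_ne_zero (hz k) (norm_coe_unitCircle t).le)]
  simp [phi, ev]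

/-- As `z 0 = 0`, the product of `z k` and the mean of `φ_k` vanishes for all `k`. -/
lemma mul_integral_phiVal (hz : ∀ k, ‖z k‖ < 1) (hz0 : z 0 = 0)
    (hν : IsOrthogonalityMeasure ν (phi z a)) (k : ℕ) :
    z k * ∫ t : UnitCircle, phiVal z a k t ∂ν = 0 := by
  rw [integral_phiVal hz hν]
  split_ifs with h
  · rw [h, hz0, zero_mul]
  · rw [mul_zero]

/-! ### The Schur iterates of a measure of orthogonality -/

/-- The Cauchy integral of `conj φ_k`. -/
noncomputable def cauchyPhi (z a : ℕ → ℂ) (ν : Measure UnitCircle) (k : ℕ) (w : ℂ) : ℂ :=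
  cauchyInt ν (fun t => conj (phiVal z a k t)) w

/-- The Cauchy integral of `(t - z_k) * conj φ_k^*`. -/
noncomputable def cauchyPhiStar (z a : ℕ → ℂ) (ν : Measure UnitCircle) (k : ℕ) (w : ℂ) : ℂ :=
  cauchyInt ν (fun t => ((t : ℂ) - z k) * conj (phiStarVal z a k t)) w

lemma continuous_conj_phiVal (hz : ∀ k, ‖z k‖ < 1) (k : ℕ) :
    Continuous fun t : UnitCircle => conj (phiVal z a k t) :=
  Complex.continuous_conj.comp (continuous_phiVal hz k)

lemma continuous_sub_mul_conj_phiStarVal (hz : ∀ k, ‖z k‖ < 1) (k : ℕ) :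
    Continuous fun t : UnitCircle => ((t : ℂ) - z k) * conj (phiStarVal z a k t) :=
  (continuous_subtype_val.sub continuous_const).mul
    (Complex.continuous_conj.comp (continuous_phiStarVal hz k))

/-- On the circle the conjugated recurrence has the same form as the original one, with the roles
of `w - z_k` and `1 - conj (z_k) * w` exchanged. -/
lemma conj_phiVal_succ (hz : ∀ k, ‖z k‖ < 1) (k : ℕ) (t : UnitCircle) :
    ((t : ℂ) - z (k + 1)) * conj (phiVal z a (k + 1) t)
      = stepConst z a k * ((1 - conj (z k) * t) * conj (phiVal z a k t)
        - a k * ((t - z k) * conj (phiStarVal z a k t))) := by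
  have h := congrArg (starRingEnd ℂ)
    (phiVal_succ (a := a) hz k (norm_coe_unitCircle t).le)
  have ht := conj_mul_coe_unitCircle t
  simp only [map_mul, map_sub, map_one, Complex.conj_conj, conj_stepConst] at h
  linear_combination (t : ℂ) * h + (z (k + 1) * conj (phiVal z a (k + 1) t)
    + stepConst z a k * conj (phiVal z a k t)
    + stepConst z a k * a k * z k * conj (phiStarVal z a k t)) * ht

lemma conj_phiStarVal_succ (hz : ∀ k, ‖z k‖ < 1) (k : ℕ) (t : UnitCircle) :
    ((t : ℂ) - z (k + 1)) * conj (phiStarVal z a (k + 1) t)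
      = stepConst z a k * ((t - z k) * conj (phiStarVal z a k t)
        - conj (a k) * ((1 - conj (z k) * t) * conj (phiVal z a k t))) := by
  have h := congrArg (starRingEnd ℂ)
    (phiStarVal_succ (a := a) hz k (norm_coe_unitCircle t).le)
  have ht := conj_mul_coe_unitCircle t
  simp only [map_mul, map_sub, map_one, Complex.conj_conj, conj_stepConst] at h
  linear_combination (t : ℂ) * h + (z (k + 1) * conj (phiStarVal z a (k + 1) t)
    - stepConst z a k * z k * conj (phiStarVal z a k t)
    - stepConst z a k * conj (a k) * conj (phiVal z a k t)) * ht

/-- The iterates of the Schur function of `ν`, as quotients of Cauchy integrals. -/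
noncomputable def schurIter (z a : ℕ → ℂ) (ν : Measure UnitCircle) (k : ℕ) (w : ℂ) : ℂ :=
  (1 - conj (z k) * w) * cauchyPhi z a ν k w / cauchyPhiStar z a ν k w

lemma b_mul_schurIter (hz : ∀ k, ‖z k‖ < 1) (k : ℕ) {w : ℂ} (hw : ‖w‖ < 1) :
    b (z k) w * schurIter z a ν k w
      = (w - z k) * cauchyPhi z a ν k w / cauchyPhiStar z a ν k w := by
  have := one_sub_conj_mul_ne_zero (hz k) hw.le
  rw [b, schurIter]
  generalize 1 - conj (z k) * w = q at *
  field_simp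

variable [IsProbabilityMeasure ν]

lemma cauchyInt_one_sub_mul_conj_phiVal (hz : ∀ k, ‖z k‖ < 1) (hz0 : z 0 = 0)
    (hν : IsOrthogonalityMeasure ν (phi z a)) (k : ℕ) {w : ℂ} (hw : ‖w‖ < 1) :
    cauchyInt ν (fun t => (1 - conj (z k) * t) * conj (phiVal z a k t)) w
      = (1 - conj (z k) * w) * cauchyPhi z a ν k w := by
  have h := cauchyInt_affine_mul ν (continuous_conj_phiVal (a := a) hz k) hw.ne 1 (-conj (z k))
  have h0 := congrArg (starRingEnd ℂ) (mul_integral_phiVal hz hz0 hν k)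
  rw [map_mul, ← integral_conj, map_zero] at h0
  rw [neg_mul (conj (z k)) (∫ _, _ ∂_), h0, neg_zero, add_zero] at h
  simpa only [cauchyPhi, neg_mul, ← sub_eq_add_neg] using h

lemma cauchyPhi_succ (hz : ∀ k, ‖z k‖ < 1) (hz0 : z 0 = 0)
    (hν : IsOrthogonalityMeasure ν (phi z a)) (k : ℕ) {w : ℂ} (hw : ‖w‖ < 1) :
    (w - z (k + 1)) * cauchyPhi z a ν (k + 1) w
      = stepConst z a k * ((1 - conj (z k) * w) * cauchyPhi z a ν k w
        - a k * cauchyPhiStar z a ν k w) := by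
  have h := cauchyInt_affine_mul ν (continuous_conj_phiVal (a := a) hz (k + 1)) hw.ne
    (-z (k + 1)) 1
  rw [integral_conj, integral_phiVal hz hν, if_neg k.succ_ne_zero, map_zero, mul_zero, add_zero]
    at h
  simp only [one_mul, neg_add_eq_sub] at h
  have h1 := cauchyInt_linear ν
    (e := fun t => (1 - conj (z k) * t) * conj (phiVal z a k t))
    ((by fun_prop : Continuous fun t : UnitCircle => 1 - conj (z k) * (t : ℂ)).mul
      (continuous_conj_phiVal (a := a) hz k))
    (continuous_sub_mul_conj_phiStarVal (a := a) hz k) hw.ne (stepConst z a k)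
    (-(stepConst z a k * a k))
  rw [cauchyInt_one_sub_mul_conj_phiVal hz hz0 hν k hw] at h1
  have e : (fun t : UnitCircle => ((t : ℂ) - z (k + 1)) * conj (phiVal z a (k + 1) t))
      = fun t : UnitCircle => stepConst z a k * ((1 - conj (z k) * t) * conj (phiVal z a k t))
        + -(stepConst z a k * a k) * ((t - z k) * conj (phiStarVal z a k t)) := by
    ext t; rw [conj_phiVal_succ hz]; ring
  rw [cauchyPhi, ← h, e, h1, cauchyPhiStar]
  ring

lemma cauchyPhiStar_succ (hz : ∀ k, ‖z k‖ < 1) (hz0 : z 0 = 0)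
    (hν : IsOrthogonalityMeasure ν (phi z a)) (k : ℕ) {w : ℂ} (hw : ‖w‖ < 1) :
    cauchyPhiStar z a ν (k + 1) w
      = stepConst z a k * (cauchyPhiStar z a ν k w
        - conj (a k) * ((1 - conj (z k) * w) * cauchyPhi z a ν k w)) := by
  have h1 := cauchyInt_linear ν
    (e := fun t => (1 - conj (z k) * t) * conj (phiVal z a k t))
    ((by fun_prop : Continuous fun t : UnitCircle => 1 - conj (z k) * (t : ℂ)).mul
      (continuous_conj_phiVal (a := a) hz k))
    (continuous_sub_mul_conj_phiStarVal (a := a) hz k) hw.ne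
    (-(stepConst z a k * conj (a k))) (stepConst z a k)
  rw [cauchyInt_one_sub_mul_conj_phiVal hz hz0 hν k hw] at h1
  have e : (fun t : UnitCircle => ((t : ℂ) - z (k + 1)) * conj (phiStarVal z a (k + 1) t))
      = fun t : UnitCircle =>
        -(stepConst z a k * conj (a k)) * ((1 - conj (z k) * t) * conj (phiVal z a k t))
        + stepConst z a k * ((t - z k) * conj (phiStarVal z a k t)) := by
    ext t; rw [conj_phiStarVal_succ hz]; ring
  rw [cauchyPhiStar, e, h1, cauchyPhiStar]
  ring

lemma caratheodory_add_one_eq (hz0 : z 0 = 0) {w : ℂ} (hw : ‖w‖ < 1) :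
    caratheodory ν w + 1 = 2 * cauchyPhiStar z a ν 0 w := by
  rw [caratheodory_add_one ν hw.ne]
  simp [cauchyPhiStar, phiStarVal, numPair, den, hz0]

variable (z a) in
lemma caratheodory_sub_one_eq {w : ℂ} (hw : ‖w‖ < 1) :
    caratheodory ν w - 1 = 2 * w * cauchyPhi z a ν 0 w := by
  rw [caratheodory_sub_one ν hw.ne]
  simp [cauchyPhi, phiVal, numPair, den]

lemma differentiableOn_schurIter (hz : ∀ k, ‖z k‖ < 1) (k : ℕ)
    (h : ∀ w : ℂ, ‖w‖ < 1 → cauchyPhiStar z a ν k w ≠ 0) :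
    DifferentiableOn ℂ (schurIter z a ν k) (Metric.ball 0 1) :=
  ((by fun_prop : DifferentiableOn ℂ (fun w => 1 - conj (z k) * w) _).mul
    (differentiableOn_cauchyInt ν (continuous_conj_phiVal hz k))).div
    (differentiableOn_cauchyInt ν (continuous_sub_mul_conj_phiStarVal hz k))
    fun w hw => h w (by simpa using hw)

lemma cauchyPhiStar_succ' (hz : ∀ k, ‖z k‖ < 1) (hz0 : z 0 = 0)
    (hν : IsOrthogonalityMeasure ν (phi z a)) (k : ℕ) {w : ℂ} (hw : ‖w‖ < 1)
    (h : cauchyPhiStar z a ν k w ≠ 0) :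
    cauchyPhiStar z a ν (k + 1) w = stepConst z a k * cauchyPhiStar z a ν k w
      * (1 - conj (a k) * schurIter z a ν k w) := by
  rw [cauchyPhiStar_succ hz hz0 hν k hw, schurIter]
  field_simp

/-- One step of the Schur algorithm. -/
lemma b_mul_schurIter_succ (hz : ∀ k, ‖z k‖ < 1) (hz0 : z 0 = 0) (ha : ∀ k, ‖a k‖ < 1)
    (hν : IsOrthogonalityMeasure ν (phi z a)) (k : ℕ) {w : ℂ} (hw : ‖w‖ < 1)
    (h : cauchyPhiStar z a ν k w ≠ 0) (h1 : ‖schurIter z a ν k w‖ ≤ 1) :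
    b (z (k + 1)) w * schurIter z a ν (k + 1) w
      = (schurIter z a ν k w - a k) / (1 - conj (a k) * schurIter z a ν k w) := by
  have hc := stepConst_ne_zero hz ha k
  have h2 := one_sub_conj_mul_ne_zero (ha k) h1
  rw [b_mul_schurIter hz _ hw, cauchyPhi_succ hz hz0 hν k hw, cauchyPhiStar_succ' hz hz0 hν k hw h]
  have e : (1 - conj (z k) * w) * cauchyPhi z a ν k w
      = schurIter z a ν k w * cauchyPhiStar z a ν k w := by
    rw [schurIter]; field_simp
  rw [e]
  field_simp

/-- At each step the Schwarz lemma passes the bound from `b (z k) * f_k` to `f_k`; the bound in turn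
keeps the next denominator away from zero. -/
lemma schurIter_bound (hz : ∀ k, ‖z k‖ < 1) (hz0 : z 0 = 0) (ha : ∀ k, ‖a k‖ < 1)
    (hν : IsOrthogonalityMeasure ν (phi z a)) (k : ℕ) :
    ∀ w : ℂ, ‖w‖ < 1 → cauchyPhiStar z a ν k w ≠ 0 ∧ ‖schurIter z a ν k w‖ ≤ 1 := by
  induction k with
  | zero =>
    have h0 : ∀ w : ℂ, ‖w‖ < 1 → cauchyPhiStar z a ν 0 w ≠ 0 := fun w hw h => by
      refine caratheodory_add_one_ne_zero ν hw ?_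
      rw [caratheodory_add_one_eq (a := a) hz0 hw, h, mul_zero]
    refine fun w hw => ⟨h0 w hw, norm_le_of_norm_b_mul_le
      (differentiableOn_schurIter hz 0 h0) (hz 0) (fun w hw => ?_) w hw⟩
    rw [b_mul_schurIter hz _ hw, norm_div, div_le_one (norm_pos_iff.mpr (h0 w hw)), hz0, sub_zero]
    have h := norm_caratheodory_sub_one_le ν hw
    rw [caratheodory_add_one_eq (a := a) hz0 hw, caratheodory_sub_one_eq z a hw, mul_assoc,
      norm_mul, norm_mul (2 : ℂ)] at h
    simpa using h
  | succ k ih =>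
    have h0 : ∀ w : ℂ, ‖w‖ < 1 → cauchyPhiStar z a ν (k + 1) w ≠ 0 := fun w hw => by
      rw [cauchyPhiStar_succ' hz hz0 hν k hw (ih w hw).1]
      exact mul_ne_zero (mul_ne_zero (stepConst_ne_zero hz ha k) (ih w hw).1)
        (one_sub_conj_mul_ne_zero (ha k) (ih w hw).2)
    refine fun w hw => ⟨h0 w hw, norm_le_of_norm_b_mul_le
      (differentiableOn_schurIter hz _ h0) (hz (k + 1)) (fun w hw => ?_) w hw⟩
    rw [b_mul_schurIter_succ hz hz0 ha hν k hw (ih w hw).1 (ih w hw).2, norm_div,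
      div_le_one (norm_pos_iff.mpr (one_sub_conj_mul_ne_zero (ha k) (ih w hw).2))]
    simpa using norm_sub_mul_le (ha k) (x := 1) (by simpa using (ih w hw).2)

/-- The Schur parameters of a measure of orthogonality are the coefficients of the recurrence. -/
theorem isSchurIterates_schurIter (hz : ∀ k, ‖z k‖ < 1) (hz0 : z 0 = 0) (ha : ∀ k, ‖a k‖ < 1)
    (hν : IsOrthogonalityMeasure ν (phi z a)) : IsSchurIterates z a (schurIter z a ν) where
  diff k := differentiableOn_schurIter hz k fun w hw => (schurIter_bound hz hz0 ha hν k w hw).1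
  bound k w hw := (schurIter_bound hz hz0 ha hν k w hw).2
  step k w hw := by
    obtain ⟨h0, h1⟩ := schurIter_bound hz hz0 ha hν k w hw
    have h2 := one_sub_conj_mul_ne_zero (ha k) h1
    rw [b_mul_schurIter_succ hz hz0 ha hν k hw h0 h1]
    generalize hq : 1 - conj (a k) * schurIter z a ν k w = q at *
    field_simp
    rw [← hq]
    ring

lemma one_sub_mul_ne_zero {w f : ℂ} (hw : ‖w‖ < 1) (hf : ‖f‖ ≤ 1) : 1 - w * f ≠ 0 := by
  simpa using one_sub_conj_mul_ne_zero (z := conj w) (by simpa using hw) hf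

theorem isSchurFunctionOf_schurIter_zero (hz : ∀ k, ‖z k‖ < 1) (hz0 : z 0 = 0)
    (ha : ∀ k, ‖a k‖ < 1) (hν : IsOrthogonalityMeasure ν (phi z a)) :
    IsSchurFunctionOf (schurIter z a ν 0) (caratheodory ν) := by
  have hs := isSchurIterates_schurIter hz hz0 ha hν
  refine ⟨hs.diff 0, hs.bound 0, fun w hw => ?_⟩
  have h0 := (schurIter_bound hz hz0 ha hν 0 w hw).1
  have h1 := one_sub_mul_ne_zero hw (hs.bound 0 w hw)
  have h2 := caratheodory_add_one_eq (a := a) (ν := ν) hz0 hw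
  have h3 := caratheodory_sub_one_eq z a (ν := ν) hw
  have e : schurIter z a ν 0 w * cauchyPhiStar z a ν 0 w = cauchyPhi z a ν 0 w := by
    rw [schurIter, hz0]; field_simp; simp
  rw [eq_div_iff h1]
  linear_combination h3 - w * schurIter z a ν 0 w * h2 - 2 * w * e

/-- The Schur function of `ν` is unique, also at the origin, where the defining identity is
vacuous. -/
theorem eq_schurIter_zero (hz : ∀ k, ‖z k‖ < 1) (hz0 : z 0 = 0)
    (ha : ∀ k, ‖a k‖ < 1) (hν : IsOrthogonalityMeasure ν (phi z a)) {f : ℂ → ℂ}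
    (hf : IsSchurFunctionOf f (caratheodory ν)) {w : ℂ} (hw : ‖w‖ < 1) :
    f w = schurIter z a ν 0 w := by
  obtain ⟨gd, gb, ge⟩ := isSchurFunctionOf_schurIter_zero hz hz0 ha hν
  obtain ⟨fd, fb, fe⟩ := hf
  -- The Schwarz lemma with the bound `0` removes the factor `w = b 0 w`.
  have h := norm_le_of_norm_b_mul_le (fd.sub gd) (z := 0) (by simp) (C := 0) (fun w hw => ?_) w hw
  · exact sub_eq_zero.mp (norm_le_zero_iff.mp h)
  · have h1 := one_sub_mul_ne_zero hw (gb w hw)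
    have h2 := one_sub_mul_ne_zero hw (fb w hw)
    have e := (fe w hw).symm.trans (ge w hw)
    rw [div_eq_div_iff h2 h1] at e
    have e' : w * (f w - schurIter z a ν 0 w) = 0 := by linear_combination e / 2
    simp [b, e']

end measure

/-! ### The functions of the second kind -/

section secondKind

variable {z a : ℕ → ℂ} {ν : Measure UnitCircle} [IsProbabilityMeasure ν]

/-- One step of the recurrence for the Cauchy integrals of `t * φ_k` and
`(1 - conj (z_k) * t) * φ_k^*`. -/
lemma cauchyInt_phiVal_succ (hz : ∀ k, ‖z k‖ < 1) (hz0 : z 0 = 0)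
    (hν : IsOrthogonalityMeasure ν (phi z a)) (k : ℕ) {w : ℂ} (hw : ‖w‖ ≠ 1) :
    (1 - conj (z (k + 1)) * w) * cauchyInt ν (fun t => t * phiVal z a (k + 1) t) w
        = stepConst z a k * ((w - z k) * cauchyInt ν (fun t => t * phiVal z a k t) w
          - conj (a k) *
            (w * cauchyInt ν (fun t => (1 - conj (z k) * t) * phiStarVal z a k t) w)) ∧
      w * cauchyInt ν (fun t => (1 - conj (z (k + 1)) * t) * phiStarVal z a (k + 1) t) w
        = stepConst z a k *
          (w * cauchyInt ν (fun t => (1 - conj (z k) * t) * phiStarVal z a k t) w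
          - a k * ((w - z k) * cauchyInt ν (fun t => t * phiVal z a k t) w)) := by
  have hφ := fun k => continuous_phiVal (a := a) hz k
  have htφ : ∀ k, Continuous fun t : UnitCircle => (t : ℂ) * phiVal z a k t :=
    fun k => continuous_subtype_val.mul (hφ k)
  have hsφ : Continuous fun t : UnitCircle => ((t : ℂ) - z k) * phiVal z a k t :=
    (continuous_subtype_val.sub continuous_const).mul (hφ k)
  have hq : Continuous fun t : UnitCircle => (1 - conj (z k) * (t : ℂ)) * phiStarVal z a k t :=
    (by fun_prop : Continuous fun t : UnitCircle => 1 - conj (z k) * (t : ℂ)).mul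
      (continuous_phiStarVal hz k)
  have hz0φ := mul_integral_phiVal hz hz0 hν k
  have hφ' : ∫ t : UnitCircle, phiVal z a (k + 1) t ∂ν = 0 := by
    rw [integral_phiVal hz hν, if_neg k.succ_ne_zero]
  constructor
  · have h1 := cauchyInt_affine_mul ν (htφ (k + 1)) hw 1 (-conj (z (k + 1)))
    have h2 := cauchyInt_affine_mul ν (htφ k) hw (-z k) 1
    have h3 := cauchyInt_affine_mul ν hq hw 0 1
    have h4 := cauchyInt_linear ν (e := fun t : UnitCircle => (-z k + 1 * t) * (t * phiVal z a k t))
      (e' := fun t : UnitCircle => (0 + 1 * (t : ℂ)) * ((1 - conj (z k) * t) * phiStarVal z a k t))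
      ((by fun_prop : Continuous fun t : UnitCircle => -z k + 1 * (t : ℂ)).mul (htφ k))
      ((by fun_prop : Continuous fun t : UnitCircle => 0 + 1 * (t : ℂ)).mul hq)
      hw (stepConst z a k) (-(stepConst z a k * conj (a k)))
    have e : (fun t : UnitCircle => (1 + -conj (z (k + 1)) * t) * (t * phiVal z a (k + 1) t))
        = fun t : UnitCircle => stepConst z a k * ((-z k + 1 * t) * (t * phiVal z a k t))
          + -(stepConst z a k * conj (a k))
            * ((0 + 1 * (t : ℂ)) * ((1 - conj (z k) * t) * phiStarVal z a k t)) := by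
      ext t
      linear_combination (t : ℂ) * phiVal_succ (a := a) hz k (norm_coe_unitCircle t).le
    -- The constant terms cancel because the integrated recurrence holds.
    have h5 : ∫ t : UnitCircle, phiVal z a (k + 1) t ∂ν
          - conj (z (k + 1)) * ∫ t : UnitCircle, t * phiVal z a (k + 1) t ∂ν
        = stepConst z a k * ((∫ t : UnitCircle, t * phiVal z a k t ∂ν)
            - z k * (∫ t : UnitCircle, phiVal z a k t ∂ν)
          - conj (a k) * ∫ t : UnitCircle, (1 - conj (z k) * t) * phiStarVal z a k t ∂ν) := by
      have i := fun {e : UnitCircle → ℂ} (he : Continuous e) => integrable_of_continuous ν he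
      have hd : Continuous fun t : UnitCircle => (t : ℂ) * phiVal z a k t - z k * phiVal z a k t :=
        (htφ k).sub (continuous_const.mul (hφ k))
      rw [← integral_const_mul, ← integral_const_mul, ← integral_const_mul,
        ← integral_sub (i (hφ _)) ((i (htφ _)).const_mul _),
        ← integral_sub (i (htφ _)) ((i (hφ _)).const_mul _),
        ← integral_sub (i hd) ((i hq).const_mul _),
        ← integral_const_mul]
      congr 1; ext t
      linear_combination phiVal_succ (a := a) hz k (norm_coe_unitCircle t).le
    rw [e, h4, h2, h3] at h1
    linear_combination -h1 - h5 + hφ' + stepConst z a k * hz0φ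
  · have h1 := cauchyInt_affine_mul ν (hφ k) hw 0 1
    have h2 := cauchyInt_affine_mul ν (hφ k) hw (-z k) 1
    have h3 := cauchyInt_linear ν hq hsφ hw (stepConst z a k) (-(stepConst z a k * a k))
    have e : (fun t : UnitCircle => (1 - conj (z (k + 1)) * t) * phiStarVal z a (k + 1) t)
        = fun t : UnitCircle => stepConst z a k * ((1 - conj (z k) * t) * phiStarVal z a k t)
          + -(stepConst z a k * a k) * ((t - z k) * phiVal z a k t) := by
      ext t
      linear_combination phiStarVal_succ (a := a) hz k (norm_coe_unitCircle t).le
    simp only [zero_add, one_mul, neg_add_eq_sub] at h1 h2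
    rw [e, h3, h1, h2]
    linear_combination -stepConst z a k * a k * hz0φ

/-- The combinations `ψ_k + F φ_k` and `-ψ_k^* + F φ_k^*` are Cauchy integrals. -/
lemma numPair_add_caratheodory_mul (hz : ∀ k, ‖z k‖ < 1) (hz0 : z 0 = 0)
    (hν : IsOrthogonalityMeasure ν (phi z a)) {w : ℂ} (hw : ‖w‖ ≠ 1) (k : ℕ) :
    (numPair z a (-1) k).1.eval w + caratheodory ν w * (numPair z a 1 k).1.eval w
        = 2 * (den z k).eval w * cauchyInt ν (fun t => t * phiVal z a k t) w ∧
      (1 - conj (z k) * w) *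
          ((numPair z a (-1) k).2.eval w + caratheodory ν w * (numPair z a 1 k).2.eval w)
        = 2 * w * (den z k).eval w
          * cauchyInt ν (fun t => (1 - conj (z k) * t) * phiStarVal z a k t) w := by
  induction k with
  | zero =>
    have h1 := caratheodory_add_one ν hw
    have h2 := caratheodory_sub_one ν hw
    constructor
    · simp [numPair, den, phiVal]
      linear_combination h1
    · simp [numPair, den, phiStarVal, hz0]
      linear_combination h2
  | succ k ih =>
    obtain ⟨ih1, ih2⟩ := ih
    obtain ⟨h1, h2⟩ := cauchyInt_phiVal_succ hz hz0 hν k hw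
    simp only [eval_numPair_succ_fst, eval_numPair_succ_snd, eval_den_succ]
    constructor
    · linear_combination stepConst z a k * ((w - z k) * ih1 - conj (a k) * ih2)
        - 2 * (den z k).eval w * h1
    · linear_combination
        (1 - conj (z (k + 1)) * w) * (stepConst z a k * (ih2 - a k * (w - z k) * ih1)
        - 2 * (den z k).eval w * h2)

omit [IsProbabilityMeasure ν] in
/-- Every zero of `π_k` is a pole of `φ_k`: it lies outside the closed disk, where the numerator has
no zero. -/
lemma eval_den_ne_zero_of_denom (hz : ∀ k, ‖z k‖ < 1) (ha : ∀ k, ‖a k‖ < 1) (k : ℕ) {w : ℂ}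
    (h : (phi z a k).denom.eval w ≠ 0) : (den z k).eval w ≠ 0 := by
  intro h0
  have hw : 1 < ‖w‖ := by
    by_contra hle
    exact eval_den_ne_zero k (fun k => one_sub_conj_mul_ne_zero (hz k) (not_lt.mp hle)) h0
  have e := (RatFunc.num_mul_eq_mul_denom_iff (den_ne_zero z k)).mpr (phi_eq_fstRat z a k)
  have e' := congrArg (Polynomial.eval w) e
  rw [Polynomial.eval_mul, Polynomial.eval_mul, h0, mul_zero] at e'
  exact mul_ne_zero (numPair_fst_ne_zero hz ha hw k).1 h e'.symm

/-- The poles of `ψ_k` are among those of `φ_k`, since both have the denominator `π_k` and it is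
reduced for `φ_k`. -/
theorem isSecondKind_fstRat (hz : ∀ k, ‖z k‖ < 1) (hz0 : z 0 = 0) (ha : ∀ k, ‖a k‖ < 1)
    (hν : IsOrthogonalityMeasure ν (phi z a)) :
    IsSecondKind ν (phi z a) (fstRat z a (-1)) := by
  refine ⟨by simp [fstRat, numPair, den], fun k hk w hw hd => ?_⟩
  have h0 := eval_den_ne_zero_of_denom hz ha k hd
  refine ⟨fun h => h0 (Polynomial.eval_eq_zero_of_dvd_of_eval_eq_zero
    (RatFunc.denom_div_dvd _ _) h), ?_⟩
  have hφ := continuous_phiVal (a := a) hz k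
  have h1 := (numPair_add_caratheodory_mul hz hz0 hν hw k).1
  have hev : ∀ t : UnitCircle, ev (phi z a k) t = phiVal z a k t := fun t =>
    ev_phi k (eval_den_ne_zero k fun k =>
      one_sub_conj_mul_ne_zero (hz k) (norm_coe_unitCircle t).le)
  simp only [hev, ev_phi k h0]
  have e : ∫ t : UnitCircle,
      (phiVal z a k t - phiVal z a k w) * (((t : ℂ) + w) / ((t : ℂ) - w)) ∂ν
      = 2 * cauchyInt ν (fun t => t * phiVal z a k t) w - ∫ t : UnitCircle, phiVal z a k t ∂ν
        - phiVal z a k w * caratheodory ν w := by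
    have hi : Integrable (fun t : UnitCircle => ((t : ℂ) + w) / ((t : ℂ) - w)) ν :=
      integrable_cauchy ν (by fun_prop) hw
    have hi' : Integrable (fun t : UnitCircle => t * phiVal z a k t / ((t : ℂ) - w)) ν :=
      integrable_cauchy ν (continuous_subtype_val.mul hφ) hw
    have hi'' := integrable_of_continuous ν hφ
    have hd : Integrable (fun t : UnitCircle =>
        2 * (t * phiVal z a k t / ((t : ℂ) - w)) - phiVal z a k t) ν := (hi'.const_mul _).sub hi''
    rw [cauchyInt, caratheodory, ← integral_const_mul, ← integral_const_mul,
      ← integral_sub (hi'.const_mul _) hi'',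
      ← integral_sub hd (hi.const_mul _)]
    congr 1; ext t
    have := coe_unitCircle_sub_ne_zero t hw
    field_simp
    ring
  rw [e, integral_phiVal hz hν, if_neg (by omega), fstRat, ev_div _ _ h0, phiVal]
  field_simp
  linear_combination h1

omit [IsProbabilityMeasure ν] in
/-- The defining integrals determine the functions of the second kind on the disk, hence as
rational functions. -/
lemma IsSecondKind.unique (hz : ∀ k, ‖z k‖ < 1) {ψ ψ' : ℕ → RatFunc ℂ}
    (h : IsSecondKind ν (phi z a) ψ) (h' : IsSecondKind ν (phi z a) ψ') (k : ℕ) : ψ k = ψ' k := by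
  rcases Nat.eq_zero_or_pos k with rfl | hk
  · rw [h.1, h'.1]
  have hpt : ∀ w ∈ Metric.ball (0 : ℂ) 1,
      ((ψ k).num * (ψ' k).denom).eval w = ((ψ' k).num * (ψ k).denom).eval w := by
    intro w hw
    have hw : ‖w‖ < 1 := by simpa using hw
    have hd : (phi z a k).denom.eval w ≠ 0 := fun h0 => by
      rw [phi_eq_fstRat] at h0
      exact eval_den_ne_zero k (fun k => one_sub_conj_mul_ne_zero (hz k) hw.le)
        (Polynomial.eval_eq_zero_of_dvd_of_eval_eq_zero (RatFunc.denom_div_dvd _ _) h0)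
    obtain ⟨h1, h2⟩ := h.2 k hk w hw.ne hd
    obtain ⟨h3, h4⟩ := h'.2 k hk w hw.ne hd
    have e := h2.trans h4.symm
    rw [ev, ev, RatFunc.eval, RatFunc.eval, Polynomial.eval₂_id, Polynomial.eval₂_id,
      Polynomial.eval₂_id, Polynomial.eval₂_id, div_eq_div_iff h1 h3] at e
    simpa using e
  have hinf : (Metric.ball (0 : ℂ) 1).Infinite :=
    infinite_of_mem_nhds 0 (Metric.ball_mem_nhds 0 one_pos)
  have e := Polynomial.eq_of_infinite_eval_eq _ _ (hinf.mono hpt)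
  have e' := (RatFunc.num_mul_eq_mul_denom_iff (RatFunc.denom_ne_zero (ψ' k))).mp e
  rw [e', RatFunc.num_div_denom]

end secondKind

/-! ### Products of transfer matrices -/

section transfer

variable {z a : ℕ → ℂ}

/-- The numerators as a row vector; up to a scalar, one step of the recurrence is multiplication by
`D_k U(a_k)` from the right. -/
lemma numPair_vecMul (hz : ∀ k, ‖z k‖ < 1) (ε : ℂ) {w : ℂ} (hw : ∀ k, 1 - conj (z k) * w ≠ 0)
    (k : ℕ) :
    ![(numPair z a ε k).1.eval w, -(numPair z a ε k).2.eval w]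
      = ((eta (z k) / eta (z 0)) * ∏ j ∈ Finset.range k, (1 - conj (z j) * w)) •
        Matrix.vecMul ![1, -ε] ((List.range k).map fun k => D (z k) w * U (a k)).prod := by
  induction k with
  | zero => simp [numPair, div_self (eta_ne_zero (hz 0))]
  | succ k ih =>
    have h0 := eta_ne_zero (hz 0)
    have h1 := eta_ne_zero (hz k)
    have h2 := hw k
    set κ := ∏ j ∈ Finset.range k, (1 - conj (z j) * w) with hκ
    have e : ((eta (z (k + 1)) / eta (z 0)) * ∏ j ∈ Finset.range (k + 1), (1 - conj (z j) * w))
        = (eta (z (k + 1)) / eta (z k) * (1 - conj (z k) * w)) * (eta (z k) / eta (z 0) * κ) := by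
      rw [Finset.prod_range_succ, ← hκ]
      field_simp
    rw [e, List.range_succ, List.map_append, List.prod_append, ← Matrix.vecMul_vecMul, mul_smul,
      ← Matrix.smul_vecMul, ← ih]
    simp only [List.map_cons, List.map_nil, List.prod_cons, List.prod_nil, mul_one]
    rw [eval_numPair_succ_fst, eval_numPair_succ_snd, stepConst]
    generalize hq : 1 - conj (z k) * w = q at *
    ext i
    fin_cases i
    · simp [U, D, b, hq]
      field_simp
      ring
    · simp [U, D, b, hq]
      field_simp
      ring

lemma prod_mul_D (p : ℕ) (w : ℂ) :
    ((List.range p).map fun k => D (z k) w * U (a k)).prod * D (z p) w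
      = D (z 0) w * ((List.range p).map fun k => U (a k) * D (z (k + 1)) w).prod := by
  induction p with
  | zero => simp
  | succ p ih =>
    simp only [List.range_succ, List.map_append, List.prod_append, List.map_cons, List.map_nil,
      List.prod_cons, List.prod_nil, mul_one]
    rw [← mul_assoc, ← mul_assoc, ih]
    simp only [mul_assoc]

lemma Y0_inv : Y0⁻¹ = !![1 / 2, -(1 / 2); 1 / 2, 1 / 2] := by
  refine Matrix.inv_eq_right_inv ?_
  ext i j
  fin_cases i <;> fin_cases j <;> norm_num [Y0, Matrix.mul_apply, Fin.sum_univ_two]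

lemma Y0_inv_mul : Y0⁻¹ * Y0 = 1 := by
  rw [Y0_inv]
  ext i j
  fin_cases i <;> fin_cases j <;> norm_num [Y0, Matrix.mul_apply, Fin.sum_univ_two]

/-- The vector of the Schur function, multiplied by `Y_0 D_0`, represents the Carathéodory
function. -/
lemma Y0_mul_D_mulVec {f F w : ℂ} (hF : F = (1 + w * f) / (1 - w * f)) (h : 1 - w * f ≠ 0) :
    (Y0 * D 0 w).mulVec ![f, 1] = (1 - w * f) • ![F, 1] := by
  ext i
  fin_cases i
  · have e := (eq_div_iff h).mp hF
    simp [Y0, D, b]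
    linear_combination -e
  · simp [Y0, D, b]
    ring

end transfer

/-! ### The transfer matrix over one period -/

section period

variable {p : ℕ} {z a : ℕ → ℂ} {ν : Measure UnitCircle} [IsProbabilityMeasure ν]

/-- Coefficient stripping over one period. -/
theorem M_mulVec_caratheodory (hp : 1 ≤ p) (hz : ∀ k, ‖z k‖ < 1) (hz0 : z 0 = 0)
    (hzp : ∀ k, z (k + p) = z k) (ha : ∀ k, ‖a k‖ < 1)
    (hν : IsOrthogonalityMeasure ν (phi z a)) {ν₁ : Measure UnitCircle} [IsProbabilityMeasure ν₁]
    (hν₁ : IsOrthogonalityMeasure ν₁ (phi z fun k => a (k + p))) {w : ℂ} (hw : ‖w‖ < 1) :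
    ∃ c : ℂ, c ≠ 0 ∧
      (M z a p w).mulVec ![caratheodory ν₁ w, 1] = c • ![caratheodory ν w, 1] := by
  have ha' : ∀ k, ‖a (k + p)‖ < 1 := fun k => ha _
  have hs := isSchurIterates_schurIter hz hz0 ha hν
  have hs₁ := isSchurIterates_schurIter hz hz0 ha' hν₁
  have hsp := hs.shift p
  simp only [hzp] at hsp
  have hf : schurIter z a ν p w = schurIter z (fun k => a (k + p)) ν₁ 0 w := by
    simpa using hsp.unique hp hz hzp ha' hs₁ hw
  obtain ⟨c, hc, e⟩ := hs.exists_smul hz ha hw p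
  have h0 := one_sub_mul_ne_zero hw (hs.bound 0 w hw)
  have h1 := one_sub_mul_ne_zero hw (hs₁.bound 0 w hw)
  have e0 := Y0_mul_D_mulVec ((isSchurFunctionOf_schurIter_zero hz hz0 ha hν).2.2 w hw) h0
  have e1 := Y0_mul_D_mulVec ((isSchurFunctionOf_schurIter_zero hz hz0 ha' hν₁).2.2 w hw) h1
  rw [← hf] at h1 e1
  set s := 1 - w * schurIter z a ν p w
  set N := ((List.range p).map fun k => D (z k) w * U (a k)).prod with hN
  have hD := prod_mul_D (z := z) (a := a) p w
  rw [show z p = 0 by simpa [hz0] using hzp 0, hz0, ← hN] at hD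
  have hM : M z a p w * (Y0 * D 0 w) = Y0 * D 0 w
      * ((List.range p).map fun k => U (a k) * D (z (k + 1)) w).prod := by
    rw [M, ← hN, mul_assoc (Y0 * N), ← mul_assoc Y0⁻¹, Y0_inv_mul, one_mul, mul_assoc, hD,
      mul_assoc]
  have key : s • (M z a p w).mulVec ![caratheodory ν₁ w, 1]
      = (c⁻¹ * (1 - w * schurIter z a ν 0 w)) • ![caratheodory ν w, 1] := by
    rw [← Matrix.mulVec_smul, ← e1, Matrix.mulVec_mulVec, hM, ← Matrix.mulVec_mulVec, mul_smul,
      ← e0, e, Matrix.mulVec_smul, smul_smul, inv_mul_cancel₀ hc, one_smul]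
  refine ⟨s⁻¹ * (c⁻¹ * (1 - w * schurIter z a ν 0 w)),
    mul_ne_zero (inv_ne_zero h1) (mul_ne_zero (inv_ne_zero hc) h0), ?_⟩
  rw [mul_smul, ← key, smul_smul, inv_mul_cancel₀ h1, one_smul]

/-- Over a full period the scalar prefactors multiply to the denominator, since `z p = z 0`. -/
lemma numPair_vecMul_period (hz : ∀ k, ‖z k‖ < 1) (hzp : ∀ k, z (k + p) = z k) (ε : ℂ) {w : ℂ}
    (hw : ∀ k, 1 - conj (z k) * w ≠ 0) :
    ![(numPair z a ε p).1.eval w, -(numPair z a ε p).2.eval w]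
      = (den z p).eval w •
        Matrix.vecMul ![1, -ε] ((List.range p).map fun k => D (z k) w * U (a k)).prod := by
  have hp0 : z p = z 0 := by simpa using hzp 0
  have hden : (den z p).eval w = ∏ j ∈ Finset.range p, (1 - conj (z j) * w) := by
    have h1 := Finset.prod_range_succ (fun j => 1 - conj (z j) * w) p
    rw [Finset.prod_range_succ', hp0] at h1
    rw [← mul_right_cancel₀ (hw 0) h1, den, Polynomial.eval_prod, Finset.range_eq_Ico,
      Finset.prod_Ico_add' (fun j => 1 - conj (z j) * w) 0 p 1]
    simp [Finset.Ico_add_one_right_eq_Icc]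
  rw [numPair_vecMul hz ε hw, hp0, div_self (eta_ne_zero (hz 0)), one_mul, hden]

theorem M_eq (hz : ∀ k, ‖z k‖ < 1) (hzp : ∀ k, z (k + p) = z k) {w : ℂ}
    (hw : ∀ k, 1 - conj (z k) * w ≠ 0) :
    M z a p w = (1 / 2 : ℂ) •
      !![ev (fstRat z a (-1) p) w + ev (rev z p (fstRat z a (-1) p)) w,
          ev (rev z p (fstRat z a (-1) p)) w - ev (fstRat z a (-1) p) w;
         ev (rev z p (phi z a p)) w - ev (phi z a p) w,
          ev (phi z a p) w + ev (rev z p (phi z a p)) w] := by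
  have hd := eval_den_ne_zero p hw
  have e1 := numPair_vecMul_period (p := p) (a := a) hz hzp 1 hw
  have e2 := numPair_vecMul_period (p := p) (a := a) hz hzp (-1) hw
  have hneg : -sndRat z a (-1) p
      = algebraMap _ _ (-(numPair z a (-1) p).2) / algebraMap _ _ (den z p) := by
    rw [sndRat, map_neg]; ring
  rw [phi_eq_fstRat, rev_fstRat_one, rev_fstRat_neg_one, hneg, fstRat, fstRat, sndRat,
    ev_div _ _ hd, ev_div _ _ hd, ev_div _ _ hd, ev_div _ _ hd, M, Y0_inv]
  set N := ((List.range p).map fun k => D (z k) w * U (a k)).prod with hN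
  have e10 := congrFun e1 0
  have e11 := congrFun e1 1
  have e20 := congrFun e2 0
  have e21 := congrFun e2 1
  simp [Matrix.vecMul, dotProduct, Fin.sum_univ_two] at e10 e11 e20 e21
  ext i j
  fin_cases i <;> fin_cases j <;>
    simp [Y0, Matrix.vecMul, dotProduct, Matrix.mul_apply, Fin.sum_univ_two] <;> field_simp
  · linear_combination -e20 - e21
  · linear_combination e20 - e21
  · linear_combination e10 + e11
  · linear_combination -e10 + e11

/-- If the coefficients are periodic up to a phase, the `p`-th Schur iterate is a rotation of the
Schur function. -/
theorem projEq_T (hp : 1 ≤ p) (hz : ∀ k, ‖z k‖ < 1) (hz0 : z 0 = 0)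
    (hzp : ∀ k, z (k + p) = z k) (ha : ∀ k, ‖a k‖ < 1)
    (hν : IsOrthogonalityMeasure ν (phi z a)) {ϑ : ℝ}
    (hϑ : ∀ k, a (k + p) = Complex.exp (-(2 * Complex.I * ϑ)) * a k) {w : ℂ} (hw : ‖w‖ < 1) :
    ProjEq ![schurIter z a ν 0 w, 1]
      (Matrix.mulVec (T z a p ϑ w) ![schurIter z a ν 0 w, 1]) := by
  have hs := isSchurIterates_schurIter hz hz0 ha hν
  have hsp := hs.shift p
  simp only [hzp, hϑ] at hsp
  have hu : ‖Complex.exp (-(2 * Complex.I * ϑ))‖ = 1 := by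
    rw [Complex.norm_exp]; simp
  have hf : schurIter z a ν p w
      = Complex.exp (-(2 * Complex.I * ϑ)) * schurIter z a ν 0 w := by
    simpa using hsp.unique hp hz hzp (fun k => by rw [norm_mul, hu, one_mul]; exact ha k)
      (hs.const_mul hu) hw
  obtain ⟨c, hc, e⟩ := hs.exists_smul hz ha hw p
  refine ⟨c * Complex.exp (-(Complex.I * ϑ)), mul_ne_zero hc (Complex.exp_ne_zero _), ?_⟩
  rw [T, ← Matrix.mulVec_mulVec, mul_smul, ← Matrix.mulVec_smul]
  refine e.trans ?_
  congr 2
  have h1 : Complex.exp (-(2 * Complex.I * ϑ))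
      = Complex.exp (-(Complex.I * ϑ)) * Complex.exp (-(Complex.I * ϑ)) := by
    rw [← Complex.exp_add]; congr 1; ring
  have h2 : Complex.exp (-(Complex.I * ϑ)) * Complex.exp (Complex.I * ϑ) = 1 := by
    rw [← Complex.exp_add]; simp
  rw [hf, h1]
  ext i
  fin_cases i
  · simp
    ring
  · simp [h2]

end period

end ORF

theorem mainTheorem5
    (p : ℕ) (hp : 1 ≤ p)
    (z : ℕ → ℂ) (hz : ∀ k, ‖z k‖ < 1) (hz0 : z 0 = 0) (hzp : ∀ k, z (k + p) = z k)
    (a : ℕ → ℂ) (ha : ∀ k, ‖a k‖ < 1)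
    (ν : MeasureTheory.Measure ORF.UnitCircle) [MeasureTheory.IsProbabilityMeasure ν]
    (hν : ORF.IsOrthogonalityMeasure ν (ORF.phi z a)) :
    -- coefficient stripping
    (∀ (ν₁ : MeasureTheory.Measure ORF.UnitCircle) [MeasureTheory.IsProbabilityMeasure ν₁],
      ORF.IsOrthogonalityMeasure ν₁ (ORF.phi z fun k => a (k + p)) →
      ∀ w : ℂ, ‖w‖ < 1 →
        ORF.M z a p w 1 0 * ORF.caratheodory ν₁ w + ORF.M z a p w 1 1 ≠ 0 ∧
        ORF.caratheodory ν w
          = (ORF.M z a p w 0 0 * ORF.caratheodory ν₁ w + ORF.M z a p w 0 1)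
            / (ORF.M z a p w 1 0 * ORF.caratheodory ν₁ w + ORF.M z a p w 1 1)) ∧
    -- the transfer matrix in terms of the functions of the first and second kind
    (∃ ψ : ℕ → RatFunc ℂ, ORF.IsSecondKind ν (ORF.phi z a) ψ) ∧
    (∀ ψ : ℕ → RatFunc ℂ, ORF.IsSecondKind ν (ORF.phi z a) ψ →
      ∀ w : ℂ, (∀ k, 1 - conj (z k) * w ≠ 0) →
        ORF.M z a p w = (1 / 2 : ℂ) •
          !![ORF.ev (ψ p) w + ORF.ev (ORF.rev z p (ψ p)) w,
              ORF.ev (ORF.rev z p (ψ p)) w - ORF.ev (ψ p) w;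
             ORF.ev (ORF.rev z p (ORF.phi z a p)) w - ORF.ev (ORF.phi z a p) w,
              ORF.ev (ORF.phi z a p) w + ORF.ev (ORF.rev z p (ORF.phi z a p)) w]) ∧
    -- the fixed-point relation for coefficients that are periodic up to a phase
    (∀ ϑ : ℝ, (∀ k, a (k + p) = Complex.exp (-(2 * Complex.I * ϑ)) * a k) →
      (∃ f : ℂ → ℂ, ORF.IsSchurFunctionOf f (ORF.caratheodory ν)) ∧
      ∀ f : ℂ → ℂ, ORF.IsSchurFunctionOf f (ORF.caratheodory ν) →
        ∀ w : ℂ, ‖w‖ < 1 →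
          ORF.ProjEq ![f w, 1] (Matrix.mulVec (ORF.T z a p ϑ w) ![f w, 1])) := by
  refine ⟨fun ν₁ _ hν₁ w hw => ?_, ⟨_, ORF.isSecondKind_fstRat hz hz0 ha hν⟩,
    fun ψ hψ w hw => ?_, fun ϑ hϑ => ⟨⟨_, ORF.isSchurFunctionOf_schurIter_zero hz hz0 ha hν⟩,
      fun f hf w hw => ?_⟩⟩
  · obtain ⟨c, hc, e⟩ := ORF.M_mulVec_caratheodory hp hz hz0 hzp ha hν hν₁ hw
    have e0 : ORF.M z a p w 0 0 * ORF.caratheodory ν₁ w + ORF.M z a p w 0 1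
        = c * ORF.caratheodory ν w := by
      simpa [Matrix.mulVec, dotProduct, Fin.sum_univ_two] using congrFun e 0
    have e1 : ORF.M z a p w 1 0 * ORF.caratheodory ν₁ w + ORF.M z a p w 1 1 = c := by
      simpa [Matrix.mulVec, dotProduct, Fin.sum_univ_two] using congrFun e 1
    rw [e0, e1]
    exact ⟨hc, by field_simp⟩
  · rw [hψ.unique hz (ORF.isSecondKind_fstRat hz hz0 ha hν) p]
    exact ORF.M_eq hz hzp hw
  · rw [ORF.eq_schurIter_zero hz hz0 ha hν hf hw]
    exact ORF.projEq_T hp hz hz0 hzp ha hν hϑ hw
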